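/- Let $\mathring{\mathfrak g}$ be a finite-dimensional simple complex Lie algebra with a Cartan subalgebra $\mathring{\mathfrak h}$, a choice of simple roots, the corresponding triangular decomposition $\mathring{\mathfrak g}=\mathring{\mathfrak n}_-\oplus\mathring{\mathfrak h}\oplus\mathring{\mathfrak n}_+$, and a non-degenerate symmetric invariant bilinear form $\langle\cdot,\cdot\rangle$. Let $\mathfrak g'=\mathring{\mathfrak g}\otimes\mathbb C[t,t^{-1}]\oplus\mathbb CK$, with $K$ central and $$[x\otimes t^n,y\otimes t^m]=[x,y]\otimes t^{n+m}+n\,\delta_{m,-n}\langle x,y\rangle K .$$ Let $\mathrm{Vir}$ be the Virasoro algebra with basis $\{d_n,C: n\in\mathbb Z\}$, $C$ central and $[d_n,d_m]=(m-n)d_{n+m}+\delta_{m,-n}\frac{n^3-n}{12}C$. Let $\mathfrak L=\mathfrak g'\rtimes\mathrm{Vir}$, where $[d_n,x\otimes t^m]=m\,x\otimes t^{m+n}$, $[d_n,K]=0$ and $[C,\mathfrak g']=0$. For a finitely generated commutative associative unital $\mathbb C$-algebra $A$ let $\mathfrak L(A)=\mathfrak L\otimes A$ with $[X\otimes a,Y\otimes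 b]=[X,Y]\otimes ab$. Identify $X\in\mathfrak L$ with $X\otimes 1$, and put $\bar{\mathfrak h}=\mathring{\mathfrak h}\oplus\mathbb CK\oplus\mathbb Cd_0\oplus\mathbb CC$. For $\lambda\in\bar{\mathfrak h}^*$ let $V_\lambda=\{v\in V: hv=\lambda(h)v\ \ \forall h\in\bar{\mathfrak h}\}$. An $\mathfrak L(A)$-module $V$ is a *weight module* if $V=\bigoplus_{\lambda\in\bar{\mathfrak h}^*}V_\lambda$. It is *integrable* if it is a weight module, every $V_\lambda$ is finite-dimensional, and $(x\otimes t^n)\otimes a$ acts locally nilpotently on $V$ for every root $\alpha$ of $\mathring{\mathfrak g}$, $x\in\mathring{\mathfrak g}_\alpha$, $n\in\mathbb Z$ and $a\in A$. Let $$\mathfrak L(A)^{\pm}=\Big(\mathring{\mathfrak n}_\pm\oplus\bigoplus_{n>0}\mathring{\mathfrak g}\otimes t^{\pm n}\oplus\bigoplus_{n>0}\mathbb Cd_{\pm n}\Big)\otimes A .$$ A *highest* (resp. *lowest*) *weight module* of highest (resp. lowest) weight $\lambda$ is a weight module $V$ with a vector $0\ne v\in V_\lambda$ such that $\mathfrak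 L(A)^+v=0$ (resp. $\mathfrak L(A)^-v=0$) and $U(\mathfrak L(A))v=V$. **Proposition.** Let $V$ be an irreducible integrable $\mathfrak L(A)$-module on which $K$ acts non-trivially. Then $V$ is a highest weight module or a lowest weight module, for some highest (resp. lowest) weight $\lambda$ with $\dim V_\lambda=1$. Moreover, if $\langle\cdot,\cdot\rangle$ is normalized so that the highest root $\theta$ of $\mathring{\mathfrak g}$ satisfies $\langle\theta,\theta\rangle=2$, then $K$ acts on $V$ by a nonzero integer $m$. In that case, if $m>0$ then $V$ is a highest weight module of some highest weight $\lambda$ with $\dim V_\lambda=1$, and if $m<0$ then $V$ is a lowest weight module of some lowest weight $\lambda$ with $\dim V_\lambda=1$. -/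

import Mathlib

open scoped TensorProduct

noncomputable section

namespace LoopAffVir

/-! ### The Virasoro algebra -/

/-- The Virasoro algebra `Vir`: the vector space with basis `d n` (`n : ℤ`) and `C`. -/
def Vir : Type := (ℤ →₀ ℂ) × ℂ

namespace Vir

instance : AddCommGroup Vir := inferInstanceAs (AddCommGroup ((ℤ →₀ ℂ) × ℂ))

instance : Module ℂ Vir := inferInstanceAs (Module ℂ ((ℤ →₀ ℂ) × ℂ))

/-- The bilinear map with `(d n, d m) ↦ (m - n) d (n + m)`. -/
def wittBracket : (ℤ →₀ ℂ) →ₗ[ℂ] (ℤ →₀ ℂ) →ₗ[ℂ] (ℤ →₀ ℂ) :=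
  Finsupp.linearCombination ℂ fun n : ℤ =>
    Finsupp.linearCombination ℂ fun m : ℤ => Finsupp.single (n + m) ((m : ℂ) - n)

/-- The bilinear map with `(d n, d m) ↦ δ_{m,-n} (n³ - n) / 12`. -/
def cocycle : (ℤ →₀ ℂ) →ₗ[ℂ] (ℤ →₀ ℂ) →ₗ[ℂ] ℂ :=
  Finsupp.linearCombination ℂ fun n : ℤ =>
    Finsupp.linearCombination ℂ fun m : ℤ => if m = -n then ((n : ℂ) ^ 3 - n) / 12 else 0

@[simp] lemma wittBracket_single (n m : ℤ) (a b : ℂ) :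
    wittBracket (Finsupp.single n a) (Finsupp.single m b) =
      Finsupp.single (n + m) (a * b * ((m : ℂ) - n)) := by
  simp only [wittBracket, Finsupp.linearCombination_single, LinearMap.smul_apply,
    Finsupp.smul_single, smul_eq_mul, mul_assoc]

@[simp] lemma cocycle_single (n m : ℤ) (a b : ℂ) :
    cocycle (Finsupp.single n a) (Finsupp.single m b) =
      if m = -n then a * b * (((n : ℂ) ^ 3 - n) / 12) else 0 := by
  simp [cocycle, mul_assoc]

lemma wittBracket_skew (x y : ℤ →₀ ℂ) : wittBracket x y = -wittBracket y x := by
  induction x using Finsupp.induction_linear with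
  | zero => simp
  | add f g hf hg => simp only [map_add, LinearMap.add_apply, hf, hg]; abel
  | single n a =>
    induction y using Finsupp.induction_linear with
    | zero => simp
    | add f g hf hg => simp only [map_add, LinearMap.add_apply, hf, hg]; abel
    | single m b =>
      rw [wittBracket_single, wittBracket_single, add_comm m n, ← Finsupp.single_neg]
      congr 1
      ring

lemma cocycle_skew (x y : ℤ →₀ ℂ) : cocycle x y = -cocycle y x := by
  induction x using Finsupp.induction_linear with
  | zero => simp
  | add f g hf hg => simp only [map_add, LinearMap.add_apply, hf, hg]; abel
  | single n a =>
    induction y using Finsupp.induction_linear with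
    | zero => simp
    | add f g hf hg => simp only [map_add, LinearMap.add_apply, hf, hg]; abel
    | single m b =>
      rw [cocycle_single, cocycle_single]
      by_cases h : m = -n
      · subst h
        simp
        ring
      · rw [if_neg h, if_neg (by omega), neg_zero]

lemma wittBracket_leibniz (x y z : ℤ →₀ ℂ) :
    wittBracket x (wittBracket y z) =
      wittBracket (wittBracket x y) z + wittBracket y (wittBracket x z) := by
  induction x using Finsupp.induction_linear with
  | zero => simp
  | add f g hf hg => simp only [map_add, LinearMap.add_apply, hf, hg]; abel
  | single n a =>
    induction y using Finsupp.induction_linear with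
    | zero => simp
    | add f g hf hg => simp only [map_add, LinearMap.add_apply, hf, hg]; abel
    | single m b =>
      induction z using Finsupp.induction_linear with
      | zero => simp
      | add f g hf hg => simp only [map_add, hf, hg]; abel
      | single k c =>
        simp only [wittBracket_single]
        rw [show n + m + k = n + (m + k) by ring, show m + (n + k) = n + (m + k) by ring,
          ← Finsupp.single_add]
        congr 1
        push_cast
        ring

lemma cocycle_leibniz (x y z : ℤ →₀ ℂ) :
    cocycle x (wittBracket y z) =
      cocycle (wittBracket x y) z + cocycle y (wittBracket x z) := by
  induction x using Finsupp.induction_linear with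
  | zero => simp
  | add f g hf hg => simp only [map_add, LinearMap.add_apply, hf, hg]; abel
  | single n a =>
    induction y using Finsupp.induction_linear with
    | zero => simp
    | add f g hf hg => simp only [map_add, LinearMap.add_apply, hf, hg]; abel
    | single m b =>
      induction z using Finsupp.induction_linear with
      | zero => simp
      | add f g hf hg => simp only [map_add, hf, hg]; abel
      | single k c =>
        simp only [wittBracket_single, cocycle_single]
        by_cases h : m + k = -n
        · obtain rfl : k = -n - m := by omega
          rw [if_pos h, if_pos (by omega), if_pos (by omega)]
          push_cast
          ring
        · rw [if_neg h, if_neg (by omega), if_neg (by omega), add_zero]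

instance : LieRing Vir where
  bracket x y := (wittBracket x.1 y.1, cocycle x.1 y.1)
  add_lie x y z := by
    change ((_, _) : (ℤ →₀ ℂ) × ℂ) = (_ + _, _ + _)
    exact Prod.ext (by simp [show (x + y).1 = x.1 + y.1 from rfl])
      (by simp [show (x + y).1 = x.1 + y.1 from rfl])
  lie_add x y z := by
    change ((_, _) : (ℤ →₀ ℂ) × ℂ) = (_ + _, _ + _)
    exact Prod.ext (by simp [show (y + z).1 = y.1 + z.1 from rfl])
      (by simp [show (y + z).1 = y.1 + z.1 from rfl])
  lie_self x := Prod.ext (self_eq_neg.mp (wittBracket_skew x.1 x.1))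
    (self_eq_neg.mp (cocycle_skew x.1 x.1))
  leibniz_lie x y z := Prod.ext (wittBracket_leibniz x.1 y.1 z.1) (cocycle_leibniz x.1 y.1 z.1)

instance : LieAlgebra ℂ Vir where
  lie_smul t x y := Prod.ext (map_smul (wittBracket x.1) t y.1) (map_smul (cocycle x.1) t y.1)

/-- The identification of `(ℤ →₀ ℂ) × ℂ` with `Vir`. -/
def ofPair : ((ℤ →₀ ℂ) × ℂ) →ₗ[ℂ] Vir := LinearMap.id

/-- The basis element `d n`. -/
def d (n : ℤ) : Vir := ofPair (Finsupp.single n 1, 0)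

/-- The central element `C`. -/
def C : Vir := ofPair (0, 1)

theorem lie_d_d (n m : ℤ) :
    ⁅d n, d m⁆ = ((m : ℂ) - n) • d (n + m) +
      (if m = -n then ((n : ℂ) ^ 3 - n) / 12 else 0) • C := by
  refine Prod.ext ?_ ?_
  · change wittBracket (Finsupp.single n 1) (Finsupp.single m 1) =
      ((m : ℂ) - n) • Finsupp.single (n + m) (1 : ℂ) + _ • (0 : ℤ →₀ ℂ)
    simp
  · change cocycle (Finsupp.single n 1) (Finsupp.single m 1) =
      ((m : ℂ) - n) • (0 : ℂ) + (if m = -n then ((n : ℂ) ^ 3 - n) / 12 else 0) • (1 : ℂ)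
    simp

theorem lie_C (x : Vir) : ⁅C, x⁆ = 0 :=
  Prod.ext (by change wittBracket 0 x.1 = 0; simp) (by change cocycle 0 x.1 = 0; simp)

end Vir

/-! ### The derived affine algebra and its semidirect product with `Vir` -/

/-- An invariant symmetric non-degenerate bilinear form `⟨·,·⟩` on a complex Lie algebra. -/
structure InvForm (𝔤 : Type*) [LieRing 𝔤] [LieAlgebra ℂ 𝔤] where
  form : LinearMap.BilinForm ℂ 𝔤
  invariant : form.lieInvariant 𝔤
  symm : form.IsSymm
  nondegenerate : form.Nondegenerate

variable {𝔤 : Type*} [LieRing 𝔤] [LieAlgebra ℂ 𝔤]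

open LieAlgebra

/-- The cocycle `(x ⊗ tⁿ, y ⊗ tᵐ) ↦ n δ_{m,-n} ⟨x, y⟩` on `𝔤 ⊗ ℂ[t, t⁻¹]`. -/
def affCocycle (Φ : InvForm 𝔤) : LieModule.Cohomology.twoCocycle ℂ (loopAlgebra ℂ ℤ 𝔤)
    (TrivialLieModule ℂ (loopAlgebra ℂ ℤ 𝔤) ℂ) :=
  LoopAlgebra.twoCocycleOfBilinear ℂ ℤ 𝔤 (-Φ.form)
    (fun x y z => by simp [Φ.invariant x y z]) ⟨fun x y => by simp [Φ.symm.eq x y]⟩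

/-- The Lie algebra `𝔤' = 𝔤 ⊗ ℂ[t, t⁻¹] ⊕ ℂ K`. -/
abbrev Aff (Φ : InvForm 𝔤) : Type _ := LieAlgebra.ofTwoCocycle (affCocycle Φ)

/-- `x ⊗ tⁿ` in the loop algebra. -/
def loopElt (x : 𝔤) (n : ℤ) : loopAlgebra ℂ ℤ 𝔤 := AddMonoidAlgebra.single n (1 : ℂ) ⊗ₜ[ℂ] x

lemma loop_induction {p : loopAlgebra ℂ ℤ 𝔤 → Prop} (z : loopAlgebra ℂ ℤ 𝔤) (h0 : p 0)
    (hadd : ∀ u v, p u → p v → p (u + v)) (hs : ∀ (x : 𝔤) n, p (loopElt x n)) : p z := by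
  obtain ⟨f, rfl⟩ := (LoopAlgebra.toFinsupp ℂ ℤ 𝔤).symm.surjective z
  induction f using Finsupp.induction_linear with
  | zero => simpa using h0
  | add f g hf hg => rw [map_add]; exact hadd _ _ hf hg
  | single n x => rw [LoopAlgebra.toFinsupp_symm_single]; exact hs x n

/-- The Lie bracket of the loop algebra as a bilinear map. -/
def loopBr : loopAlgebra ℂ ℤ 𝔤 →ₗ[ℂ] loopAlgebra ℂ ℤ 𝔤 →ₗ[ℂ] loopAlgebra ℂ ℤ 𝔤 :=
  (LieAlgebra.ad ℂ (loopAlgebra ℂ ℤ 𝔤) : loopAlgebra ℂ ℤ 𝔤 →ₗ[ℂ] _)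

lemma loopBr_loopElt (x y : 𝔤) (n m : ℤ) :
    loopBr (loopElt x n) (loopElt y m) = loopElt ⁅x, y⁆ (n + m) := by
  change (AddMonoidAlgebra.single n (1 : ℂ) * AddMonoidAlgebra.single m (1 : ℂ)) ⊗ₜ[ℂ] ⁅x, y⁆ = _
  rw [AddMonoidAlgebra.single_mul_single, one_mul, loopElt]

lemma affCocycle_loopElt (Φ : InvForm 𝔤) (x y : 𝔤) (n m : ℤ) :
    (affCocycle Φ : loopAlgebra ℂ ℤ 𝔤 →ₗ[ℂ] loopAlgebra ℂ ℤ 𝔤 →ₗ[ℂ]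
      TrivialLieModule ℂ (loopAlgebra ℂ ℤ 𝔤) ℂ) (loopElt x n) (loopElt y m) =
      (TrivialLieModule.equiv ℂ (loopAlgebra ℂ ℤ 𝔤) ℂ).symm
        (if m = -n then (n : ℂ) * Φ.form x y else 0) := by
  change LoopAlgebra.residuePairing ℂ ℤ 𝔤 (-Φ.form) (loopElt x n) (loopElt y m) = _
  rw [LoopAlgebra.residuePairing_apply_apply, loopElt, loopElt,
    LoopAlgebra.toFinsupp_single_tmul, LoopAlgebra.toFinsupp_single_tmul,
    Finsupp.sum_single_index (by simp)]
  by_cases h : m = -n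
  · subst h
    simp
    rfl
  · rw [if_neg h, Finsupp.single_eq_of_ne (by omega)]
    simp
    rfl

/-- The linear map `tᵐ ↦ m tᵐ⁺ⁿ`, that is `tⁿ⁺¹ d/dt`, depending linearly on `n : ℤ →₀ ℂ`. -/
def laurentDer : (ℤ →₀ ℂ) →ₗ[ℂ] AddMonoidAlgebra ℂ ℤ →ₗ[ℂ] AddMonoidAlgebra ℂ ℤ :=
  Finsupp.linearCombination ℂ fun n : ℤ =>
    (AddMonoidAlgebra.basis ℤ ℂ).constr ℂ fun m : ℤ => (m : ℂ) • AddMonoidAlgebra.single (m + n) 1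

/-- The action of `∑ fₙ d n` on the loop algebra, `d n · (x ⊗ tᵐ) = m x ⊗ tᵐ⁺ⁿ`. -/
def loopDer : (ℤ →₀ ℂ) →ₗ[ℂ] loopAlgebra ℂ ℤ 𝔤 →ₗ[ℂ] loopAlgebra ℂ ℤ 𝔤 :=
  (LinearMap.rTensorHom 𝔤).comp laurentDer

lemma loopDer_loopElt (x : 𝔤) (n m : ℤ) (a : ℂ) :
    loopDer (Finsupp.single n a) (loopElt x m) = (a * m) • loopElt x (m + n) := by
  have h : laurentDer (Finsupp.single n a) (AddMonoidAlgebra.single m 1) =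
      (a * m) • AddMonoidAlgebra.single (m + n) (1 : ℂ) := by
    rw [laurentDer, Finsupp.linearCombination_single, LinearMap.smul_apply,
      ← AddMonoidAlgebra.basis_apply, Module.Basis.constr_basis, smul_smul]
  change LinearMap.rTensor 𝔤 _ (_ ⊗ₜ x) = _
  rw [LinearMap.rTensor_tmul, h]
  rfl

lemma loopDer_loopBr (f : ℤ →₀ ℂ) (u v : loopAlgebra ℂ ℤ 𝔤) :
    loopDer f (loopBr u v) = loopBr (loopDer f u) v + loopBr u (loopDer f v) := by
  induction f using Finsupp.induction_linear with
  | zero => simp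
  | add f g hf hg => simp only [map_add, LinearMap.add_apply, hf, hg]; abel
  | single n a =>
    induction u using loop_induction with
    | h0 => simp
    | hadd u u' hu hu' => simp only [map_add, LinearMap.add_apply, hu, hu']; abel
    | hs x p =>
      induction v using loop_induction with
      | h0 => simp
      | hadd v v' hv hv' => simp only [map_add, hv, hv']; abel
      | hs y q =>
        rw [loopBr_loopElt, loopDer_loopElt, loopDer_loopElt, loopDer_loopElt, map_smul, map_smul,
          LinearMap.smul_apply, loopBr_loopElt, loopBr_loopElt,
          show p + n + q = p + q + n by ring, ← add_assoc, ← add_smul]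
        congr 1
        push_cast
        ring

lemma loopDer_affCocycle (Φ : InvForm 𝔤) (f : ℤ →₀ ℂ) (u v : loopAlgebra ℂ ℤ 𝔤) :
    (affCocycle Φ : loopAlgebra ℂ ℤ 𝔤 →ₗ[ℂ] loopAlgebra ℂ ℤ 𝔤 →ₗ[ℂ]
      TrivialLieModule ℂ (loopAlgebra ℂ ℤ 𝔤) ℂ) (loopDer f u) v +
    (affCocycle Φ : loopAlgebra ℂ ℤ 𝔤 →ₗ[ℂ] loopAlgebra ℂ ℤ 𝔤 →ₗ[ℂ]
      TrivialLieModule ℂ (loopAlgebra ℂ ℤ 𝔤) ℂ) u (loopDer f v) = 0 := by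
  generalize hB : (affCocycle Φ : loopAlgebra ℂ ℤ 𝔤 →ₗ[ℂ] loopAlgebra ℂ ℤ 𝔤 →ₗ[ℂ]
      TrivialLieModule ℂ (loopAlgebra ℂ ℤ 𝔤) ℂ) = B
  induction f using Finsupp.induction_linear with
  | zero => simp
  | add f g hf hg =>
    simp only [map_add, LinearMap.add_apply]
    rw [add_add_add_comm, hf, hg, add_zero]
  | single n a =>
    induction u using loop_induction with
    | h0 => simp
    | hadd u u' hu hu' =>
      simp only [map_add, LinearMap.add_apply]
      rw [add_add_add_comm, hu, hu', add_zero]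
    | hs x p =>
      induction v using loop_induction with
      | h0 => simp
      | hadd v v' hv hv' =>
        simp only [map_add]
        rw [add_add_add_comm, hv, hv', add_zero]
      | hs y q =>
        rw [loopDer_loopElt, loopDer_loopElt, map_smul, map_smul, LinearMap.smul_apply, ← hB,
          affCocycle_loopElt, affCocycle_loopElt, ← map_smul, ← map_smul, ← map_add]
        by_cases h : q = -(p + n)
        · subst h
          rw [if_pos rfl, if_pos (by ring), LinearEquiv.map_eq_zero_iff]
          simp only [smul_eq_mul]
          push_cast
          ring
        · rw [if_neg h, if_neg (by omega), smul_zero, smul_zero, add_zero, map_zero]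

lemma loopDer_comm (f g : ℤ →₀ ℂ) (u : loopAlgebra ℂ ℤ 𝔤) :
    loopDer (Vir.wittBracket f g) u = loopDer f (loopDer g u) - loopDer g (loopDer f u) := by
  induction f using Finsupp.induction_linear with
  | zero => simp
  | add f f' hf hf' => simp only [map_add, LinearMap.add_apply, hf, hf']; abel
  | single n a =>
    induction g using Finsupp.induction_linear with
    | zero => simp
    | add f f' hf hf' => simp only [map_add, LinearMap.add_apply, hf, hf']; abel
    | single m b =>
      induction u using loop_induction with
      | h0 => simp
      | hadd u u' hu hu' => simp only [map_add, hu, hu']; abel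
      | hs x p =>
        rw [Vir.wittBracket_single]
        simp only [loopDer_loopElt, map_smul, smul_smul]
        rw [show p + m + n = p + (n + m) by ring, show p + n + m = p + (n + m) by ring, ← sub_smul]
        congr 1
        push_cast
        ring

lemma Aff.lie_def (Φ : InvForm 𝔤) (y z : Aff Φ) : ⁅y, z⁆ =
    ofProd (affCocycle Φ) (loopBr y.carrier.1 z.carrier.1,
      (affCocycle Φ : loopAlgebra ℂ ℤ 𝔤 →ₗ[ℂ] loopAlgebra ℂ ℤ 𝔤 →ₗ[ℂ]
        TrivialLieModule ℂ (loopAlgebra ℂ ℤ 𝔤) ℂ) y.carrier.1 z.carrier.1) := by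
  rw [bracket_ofTwoCocycle]
  refine congrArg _ (Prod.ext rfl ?_)
  exact (sub_zero _).trans (add_zero _)

/-- The derivation of `𝔤'` given by `d n · (x ⊗ tᵐ) = m x ⊗ tᵐ⁺ⁿ` and `d n · K = 0`. -/
def affDer (Φ : InvForm 𝔤) (f : ℤ →₀ ℂ) : LieDerivation ℂ (Aff Φ) (Aff Φ) where
  toFun z := ofProd (affCocycle Φ) (loopDer f z.carrier.1, 0)
  map_add' y z := by
    rw [← of_add, Prod.mk_add_mk, add_zero, ← map_add]
    rfl
  map_smul' t z := by
    rw [RingHom.id_apply, ← of_smul, Prod.smul_mk, smul_zero, ← map_smul]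
    rfl
  leibniz' y z := by
    change ofProd (affCocycle Φ) (_, 0) =
      ⁅y, ofProd (affCocycle Φ) (loopDer f z.carrier.1, 0)⁆ -
        ⁅z, ofProd (affCocycle Φ) (loopDer f y.carrier.1, 0)⁆
    rw [← lie_skew z, sub_neg_eq_add, Aff.lie_def, Aff.lie_def, Aff.lie_def, ← of_add,
      Prod.mk_add_mk]
    refine congrArg _ (Prod.ext ?_ ?_)
    · exact (loopDer_loopBr f _ _).trans (add_comm _ _)
    · exact ((add_comm _ _).trans (loopDer_affCocycle Φ f _ _)).symm

/-- The homomorphism `Vir → Der 𝔤'`; the element `C` acts by zero. -/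
def virAct (Φ : InvForm 𝔤) : Vir →ₗ⁅ℂ⁆ LieDerivation ℂ (Aff Φ) (Aff Φ) where
  toFun z := affDer Φ z.1
  map_add' y z := by
    ext w
    change ofProd (affCocycle Φ) (loopDer (y.1 + z.1) w.carrier.1, 0) =
      ofProd (affCocycle Φ) (_, 0) + ofProd (affCocycle Φ) (_, 0)
    rw [← of_add, Prod.mk_add_mk, add_zero, map_add]
    rfl
  map_smul' t z := by
    ext w
    change ofProd (affCocycle Φ) (loopDer (t • z.1) w.carrier.1, 0) =
      t • ofProd (affCocycle Φ) (_, 0)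
    rw [← of_smul, Prod.smul_mk, smul_zero, map_smul]
    rfl
  map_lie' {y z} := by
    ext w
    rw [LieDerivation.lie_apply]
    change ofProd (affCocycle Φ) (loopDer (Vir.wittBracket y.1 z.1) w.carrier.1, 0) =
      ofProd (affCocycle Φ) (loopDer y.1 (loopDer z.1 w.carrier.1), 0) -
        ofProd (affCocycle Φ) (loopDer z.1 (loopDer y.1 w.carrier.1), 0)
    rw [eq_sub_iff_add_eq, ← of_add, Prod.mk_add_mk, add_zero, loopDer_comm, sub_add_cancel]

/-- The affine-Virasoro algebra `𝔏 = 𝔤' ⋊ Vir`. -/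
abbrev AffVir (Φ : InvForm 𝔤) : Type _ := Aff Φ ⋊⁅virAct Φ⁆ Vir

namespace AffVir

variable (Φ : InvForm 𝔤)

/-- The element `x ⊗ tⁿ` of `𝔏`, as a linear function of `x`. -/
def x (n : ℤ) : 𝔤 →ₗ[ℂ] AffVir Φ where
  toFun y := SemiDirectSum.inl (virAct Φ) (ofProd (affCocycle Φ) (loopElt y n, 0))
  map_add' y z := by
    rw [← map_add, ← of_add, Prod.mk_add_mk, add_zero, loopElt, TensorProduct.tmul_add]
    rfl
  map_smul' t y := by
    rw [RingHom.id_apply, ← map_smul, ← of_smul, Prod.smul_mk, smul_zero, loopElt,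
      TensorProduct.tmul_smul]
    rfl

/-- The central element `K` of `𝔏`. -/
def K : AffVir Φ := SemiDirectSum.inl (virAct Φ) (ofProd (affCocycle Φ)
  (0, (TrivialLieModule.equiv ℂ (loopAlgebra ℂ ℤ 𝔤) ℂ).symm 1))

/-- The element `d n` of `𝔏`. -/
def d (n : ℤ) : AffVir Φ := SemiDirectSum.inr (virAct Φ) (Vir.d n)

/-- The Virasoro central element `C` of `𝔏`. -/
def C : AffVir Φ := SemiDirectSum.inr (virAct Φ) Vir.C

theorem lie_x_x (n m : ℤ) (y z : 𝔤) :
    ⁅x Φ n y, x Φ m z⁆ = x Φ (n + m) ⁅y, z⁆ +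
      (if m = -n then (n : ℂ) * Φ.form y z else 0) • K Φ := by
  change ⁅SemiDirectSum.inl (virAct Φ) _, SemiDirectSum.inl (virAct Φ) _⁆ =
    SemiDirectSum.inl (virAct Φ) _ + _ • SemiDirectSum.inl (virAct Φ) _
  rw [← LieHom.map_lie, ← map_smul, ← map_add, Aff.lie_def, ← of_smul, ← of_add]
  refine congrArg _ (congrArg _ (Prod.ext ?_ ?_))
  · refine (loopBr_loopElt y z n m).trans ?_
    rw [Prod.fst_add, Prod.smul_fst, smul_zero, add_zero]
  · refine (affCocycle_loopElt Φ y z n m).trans ?_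
    rw [Prod.snd_add, zero_add, Prod.smul_snd, ← map_smul, smul_eq_mul, mul_one]

theorem lie_d_x (n m : ℤ) (y : 𝔤) : ⁅d Φ n, x Φ m y⁆ = (m : ℂ) • x Φ (m + n) y := by
  rw [← map_smul]
  refine SemiDirectSum.ext ?_ ?_
  · change ⁅(0 : Aff Φ), _⁆ + ofProd (affCocycle Φ) (loopDer (Finsupp.single n 1) (loopElt y m), 0) -
      virAct Φ 0 0 = ofProd (affCocycle Φ) (loopElt ((m : ℂ) • y) (m + n), 0)
    rw [zero_lie, zero_add, map_zero, sub_zero, loopDer_loopElt, one_mul, loopElt, loopElt,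
      TensorProduct.tmul_smul]
  · exact lie_zero _

theorem lie_d_d (n m : ℤ) :
    ⁅d Φ n, d Φ m⁆ = ((m : ℂ) - n) • d Φ (n + m) +
      (if m = -n then ((n : ℂ) ^ 3 - n) / 12 else 0) • C Φ := by
  rw [d, d, d, C, ← LieHom.map_lie, Vir.lie_d_d, map_add, map_smul, map_smul]

theorem lie_K (z : AffVir Φ) : ⁅K Φ, z⁆ = 0 := by
  refine SemiDirectSum.ext ?_ (zero_lie _)
  change ⁅ofProd (affCocycle Φ) (0, _), z.left⁆ + virAct Φ 0 z.left -
    ofProd (affCocycle Φ) (loopDer z.right.1 0, 0) = 0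
  rw [Aff.lie_def, map_zero, map_zero]
  change ofProd (affCocycle Φ) (loopBr 0 _, _) + 0 - 0 = 0
  rw [add_zero, sub_zero, map_zero]
  refine congrArg (ofProd (affCocycle Φ)) (Prod.ext rfl ?_)
  exact LinearMap.congr_fun (map_zero _) _

theorem lie_C (z : AffVir Φ) : ⁅C Φ, z⁆ = 0 := by
  refine SemiDirectSum.ext ?_ (Vir.lie_C _)
  change ⁅(0 : Aff Φ), z.left⁆ + ofProd (affCocycle Φ) (loopDer 0 _, 0) - virAct Φ z.right 0 = 0
  rw [zero_lie, map_zero, map_zero, LinearMap.zero_apply, zero_add, sub_zero]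
  rfl

theorem span_eq_top : Submodule.span ℂ
    ({z | ∃ n y, z = x Φ n y} ∪ {z | ∃ n, z = d Φ n} ∪ {K Φ, C Φ}) = ⊤ := by
  set S := Submodule.span ℂ
    ({z | ∃ n y, z = x Φ n y} ∪ {z | ∃ n, z = d Φ n} ∪ {K Φ, C Φ}) with hS
  refine eq_top_iff.mpr fun z _ => ?_
  have h1 : ∀ u : loopAlgebra ℂ ℤ 𝔤,
      SemiDirectSum.inl (virAct Φ) (ofProd (affCocycle Φ) (u, 0)) ∈ S := by
    intro u
    induction u using loop_induction with
    | h0 => exact S.zero_mem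
    | hadd u v hu hv =>
      have := S.add_mem hu hv
      rwa [← map_add, ← of_add, Prod.mk_add_mk, add_zero] at this
    | hs y n => exact Submodule.subset_span (Or.inl (Or.inl ⟨n, y, rfl⟩))
  have h2 : ∀ k : ℂ, SemiDirectSum.inl (virAct Φ) (ofProd (affCocycle Φ)
      (0, (TrivialLieModule.equiv ℂ (loopAlgebra ℂ ℤ 𝔤) ℂ).symm k)) ∈ S := by
    intro k
    have := S.smul_mem k (Submodule.subset_span (Or.inr (Or.inl rfl)) : K Φ ∈ S)
    rwa [K, ← map_smul, ← of_smul, Prod.smul_mk, smul_zero, ← map_smul, smul_eq_mul,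
      mul_one] at this
  have h3 : ∀ f : ℤ →₀ ℂ, SemiDirectSum.inr (virAct Φ) (Vir.ofPair (f, 0)) ∈ S := by
    intro f
    induction f using Finsupp.induction_linear with
    | zero => exact S.zero_mem
    | add f g hf hg =>
      have := S.add_mem hf hg
      rwa [← map_add, ← map_add, Prod.mk_add_mk, add_zero] at this
    | single n a =>
      have := S.smul_mem a (Submodule.subset_span (Or.inl (Or.inr ⟨n, rfl⟩)) : d Φ n ∈ S)
      rwa [d, Vir.d, ← map_smul, ← map_smul, Prod.smul_mk, smul_zero, Finsupp.smul_single,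
        smul_eq_mul, mul_one] at this
  have h4 : ∀ c : ℂ, SemiDirectSum.inr (virAct Φ) (Vir.ofPair (0, c)) ∈ S := by
    intro c
    have := S.smul_mem c (Submodule.subset_span (Or.inr (Or.inr rfl)) : C Φ ∈ S)
    rwa [C, Vir.C, ← map_smul, ← map_smul, Prod.smul_mk, smul_zero, smul_eq_mul, mul_one] at this
  obtain ⟨⟨u, k⟩, f, c⟩ := z
  obtain ⟨k, rfl⟩ := (TrivialLieModule.equiv ℂ (loopAlgebra ℂ ℤ 𝔤) ℂ).symm.surjective k
  have := S.add_mem (S.add_mem (h1 u) (h2 k)) (S.add_mem (h3 f) (h4 c))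
  rw [← map_add, ← of_add, ← map_add, ← map_add, Prod.mk_add_mk, Prod.mk_add_mk, zero_add,
    zero_add, add_zero, add_zero] at this
  convert this using 1
  refine SemiDirectSum.ext ?_ ?_
  · exact (add_zero (ofProd (affCocycle Φ) _)).symm
  · exact (zero_add (Vir.ofPair (f, c))).symm

end AffVir

/-! ### The loop algebra of the affine-Virasoro algebra -/

/-- The loop affine-Virasoro algebra `𝔏(A) = 𝔏 ⊗ A`, with `[X ⊗ a, Y ⊗ b] = [X, Y] ⊗ ab`. -/
def LA (A : Type*) [CommRing A] [Algebra ℂ A] (Φ : InvForm 𝔤) : Type _ := A ⊗[ℂ] AffVir Φ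

namespace LA

variable (A : Type*) [CommRing A] [Algebra ℂ A] (Φ : InvForm 𝔤)

instance : LieRing (LA A Φ) := inferInstanceAs (LieRing (A ⊗[ℂ] AffVir Φ))

instance : LieAlgebra ℂ (LA A Φ) := inferInstanceAs (LieAlgebra ℂ (A ⊗[ℂ] AffVir Φ))

variable {A Φ}

/-- The element `X ⊗ a` of `𝔏(A)`, as a bilinear function. -/
def tmul : AffVir Φ →ₗ[ℂ] A →ₗ[ℂ] LA A Φ := (TensorProduct.mk ℂ A (AffVir Φ)).flip

theorem lie_tmul (X Y : AffVir Φ) (a b : A) : ⁅tmul X a, tmul Y b⁆ = tmul ⁅X, Y⁆ (a * b) := rfl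

theorem span_tmul : Submodule.span ℂ {z : LA A Φ | ∃ X a, z = tmul X a} = ⊤ := by
  refine (TensorProduct.span_tmul_eq_top ℂ A (AffVir Φ)).symm.trans ?_ |>.symm
  refine congrArg _ (Set.ext fun z => ?_)
  exact ⟨fun ⟨a, X, h⟩ => ⟨X, a, h.symm⟩, fun ⟨X, a, h⟩ => ⟨a, X, h.symm⟩⟩

end LA

/-! ### Modules -/

section Modules

variable (A : Type*) [CommRing A] [Algebra ℂ A] (Φ : InvForm 𝔤) (H : LieSubalgebra ℂ 𝔤)
  (V : Type*) [AddCommGroup V] [Module ℂ V] [LieRingModule (LA A Φ) V] [LieModule ℂ (LA A Φ) V]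

/-- The space `𝔥 ⊕ ℂ K ⊕ ℂ d 0 ⊕ ℂ C`, where `𝔥 ⊆ 𝔤` is a given subalgebra. -/
abbrev Cartan : Type _ := H × ℂ × ℂ × ℂ

/-- The inclusion `(h, k, r, c) ↦ h ⊗ 1 + k K + r d 0 + c C` of `𝔥 ⊕ ℂ K ⊕ ℂ d 0 ⊕ ℂ C` in `𝔏`. -/
def cartanIncl : Cartan H →ₗ[ℂ] AffVir Φ :=
  ((AffVir.x Φ 0).comp H.subtype).coprod
    ((LinearMap.toSpanSingleton ℂ _ (AffVir.K Φ)).coprod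
      ((LinearMap.toSpanSingleton ℂ _ (AffVir.d Φ 0)).coprod
        (LinearMap.toSpanSingleton ℂ _ (AffVir.C Φ))))

theorem cartanIncl_apply (h : H) (k r c : ℂ) : cartanIncl Φ H (h, k, r, c) =
    AffVir.x Φ 0 (h : 𝔤) + (k • AffVir.K Φ + (r • AffVir.d Φ 0 + c • AffVir.C Φ)) := rfl

/-- The weight space `V_μ`. -/
def weightSpace (μ : Module.Dual ℂ (Cartan H)) : Submodule ℂ V where
  carrier := {v | ∀ h : Cartan H, ⁅(LA.tmul (cartanIncl Φ H h) 1 : LA A Φ), v⁆ = μ h • v}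
  add_mem' hv hw h := by rw [lie_add, hv h, hw h, smul_add]
  zero_mem' h := by rw [lie_zero, smul_zero]
  smul_mem' t v hv h := by rw [lie_smul, hv h, smul_comm]

/-- `V` is the direct sum of its weight spaces. -/
def IsWeightModule : Prop :=
  iSupIndep (weightSpace A Φ H V) ∧ ⨆ μ, weightSpace A Φ H V μ = ⊤

variable [LieAlgebra.IsKilling ℂ 𝔤] [FiniteDimensional ℂ 𝔤] [H.IsCartanSubalgebra]

/-- Integrable modules: weight modules with finite-dimensional weight spaces on which all
`(y ⊗ tⁿ) ⊗ a`, with `y` in a root space of `𝔤`, act locally nilpotently. -/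
structure IsIntegrable : Prop where
  isWeightModule : IsWeightModule A Φ H V
  finiteDimensional : ∀ μ, FiniteDimensional ℂ (weightSpace A Φ H V μ)
  locallyNilpotent : ∀ (α : H.root) (n : ℤ) (y : 𝔤), y ∈ rootSpace H α.1 → ∀ (a : A) (v : V),
    ∃ N : ℕ, (LieModule.toEnd ℂ (LA A Φ) V (LA.tmul (AffVir.x Φ n y) a) ^ N) v = 0

variable {H} (b : (LieAlgebra.IsKilling.rootSystem H).Base)

/-- The subspace `𝔫₊ ⊕ Vir⁺` of `𝔏`, where `𝔫₊` is the sum of the positive root spaces of `𝔤`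
(for the base `b`) and of `𝔤 ⊗ t ℂ[t]`, and `Vir⁺` is spanned by the `d n` with `n > 0`. -/
def posPart : Submodule ℂ (AffVir Φ) := Submodule.span ℂ
  ({X | ∃ α : H.root, b.IsPos α ∧ ∃ y ∈ rootSpace H α.1, X = AffVir.x Φ 0 y} ∪
    {X | ∃ n : ℤ, 0 < n ∧ ∃ y : 𝔤, X = AffVir.x Φ n y} ∪
    {X | ∃ n : ℤ, 0 < n ∧ X = AffVir.d Φ n})

/-- The subspace `𝔫₋ ⊕ Vir⁻` of `𝔏`. -/
def negPart : Submodule ℂ (AffVir Φ) := Submodule.span ℂ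
  ({X | ∃ α : H.root, b.IsPos α ∧ ∃ y ∈ rootSpace H (-(α.1 : H → ℂ)), X = AffVir.x Φ 0 y} ∪
    {X | ∃ n : ℤ, n < 0 ∧ ∃ y : 𝔤, X = AffVir.x Φ n y} ∪
    {X | ∃ n : ℤ, n < 0 ∧ X = AffVir.d Φ n})

/-- The subspace `P ⊗ A` of `𝔏(A)`, for a subspace `P` of `𝔏`. -/
def loopOf {Φ : InvForm 𝔤} (P : Submodule ℂ (AffVir Φ)) : Submodule ℂ (LA A Φ) :=
  Submodule.span ℂ {z | ∃ X ∈ P, ∃ a : A, z = LA.tmul X a}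

/-- `V` is a weight module generated, over the universal enveloping algebra of `𝔏(A)`, by a nonzero
vector of weight `μ` which is annihilated by the subspace `N` of `𝔏(A)`. -/
def IsGeneratedByExtremal (H : LieSubalgebra ℂ 𝔤) (N : Submodule ℂ (LA A Φ))
    (μ : Module.Dual ℂ (Cartan H)) : Prop :=
  IsWeightModule A Φ H V ∧ ∃ v ∈ weightSpace A Φ H V μ, v ≠ 0 ∧ (∀ z ∈ N, ⁅z, v⁆ = 0) ∧
    ∀ w : V, ∃ u : UniversalEnvelopingAlgebra ℂ (LA A Φ),
      UniversalEnvelopingAlgebra.lift ℂ (LieModule.toEnd ℂ (LA A Φ) V) u v = w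

/-- `V` is a highest weight module with highest weight `μ`. -/
def IsHighestWeightModule (μ : Module.Dual ℂ (Cartan H)) : Prop :=
  IsGeneratedByExtremal A Φ V H (loopOf A (posPart Φ b)) μ

/-- `V` is a lowest weight module with lowest weight `μ`. -/
def IsLowestWeightModule (μ : Module.Dual ℂ (Cartan H)) : Prop :=
  IsGeneratedByExtremal A Φ V H (loopOf A (negPart Φ b)) μ

/-- The form is normalized: the highest root `θ` (the root `θ` such that `θ - β` is a sum of simple
roots for every root `β`) has square length `2`. As the coroot of `θ` has square length
`4 / ⟨θ, θ⟩`, this says that `⟨θ^∨, θ^∨⟩ = 2`. -/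
def IsNormalized : Prop :=
  ∃ θ : H.root,
    (∀ β : H.root, (LieAlgebra.IsKilling.rootSystem H).root θ -
        (LieAlgebra.IsKilling.rootSystem H).root β ∈
      AddSubmonoid.closure ((LieAlgebra.IsKilling.rootSystem H).root '' b.support)) ∧
    Φ.form (LieAlgebra.IsKilling.coroot θ.1 : 𝔤) (LieAlgebra.IsKilling.coroot θ.1 : 𝔤) = 2

end Modules

end LoopAffVir

end

open LoopAffVir

noncomputable section

namespace LoopAffVir

/-! ### Operators: `sl₂`-triples and Heisenberg pairs -/

section Operators

attribute [local instance] LieRing.ofAssociativeRing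

variable {V : Type*} [AddCommGroup V] [Module ℂ V]

/-! `K` is central and has an eigenvector, so by irreducibility it acts by a scalar `c`, and `c ≠
0`. Fix the eigenvalues of `K` and `C` and a coset `r + ℤ` of eigenvalues of `d 0`; the weight
spaces become pieces `W l n`, with `l` a weight of the finite Cartan subalgebra and `n` the degree
(`AffRep`).

For each real affine root `α + kδ` there is an `sl₂`-triple acting locally nilpotently, so `l (α^∨)
+ k q α` is an integer on nonzero pieces, where `q α = c ⟨α^∨, α^∨⟩ / 2`. Since the form is a
multiple of the Killing form, the integers `q α` are nonzero and share one sign. Say they are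
positive; the substitution `t ↦ t⁻¹` handles the other sign.

The lowering operators of `α + kδ` are injective where `l (α^∨) + k q α > 0`. Lowering with `α` and
then `-α` embeds `W l n` in `W l (n - m)` for large `m`, so for fixed `l` the dimensions stay
bounded as `n` grows. On the other hand, `h ⊗ t^{±1}` and `h ⊗ t^{±2}` form two commuting Heisenberg
pairs when `c ≠ 0`, and these force unbounded dimensions near any nonzero piece
(`heisenberg_growth`). Hence `W l n = 0` for large `n` (`eventually_bot`).

The bound becomes uniform in `l` by descent: if `l (α^∨) > q α`, an operator of degree one maps `W l
n` injectively to `W (l - α) (n + 1)`, and `l - α` is shorter than `l`. The descent ends in a finite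
set of weights, so there is a top degree, with finitely many weights (`exists_greatest`). A weight
of greatest height there is annihilated by the positive part tensored with `A`. A triangular
decomposition argument and the commutativity of the Cartan part tensored with `A` make this weight
space a line. -/

theorem eigenvalue_nat_of_primitive {h e f : Module.End ℂ V} (t : IsSl2Triple h e f) {v : V}
    {μ : ℂ} (P : t.HasPrimitiveVectorWith v μ) (hf : ∃ N, (f ^ N) v = 0) : ∃ n : ℕ, μ = n := by
  have hf' : ∃ N, ((LieModule.toEnd ℂ (Module.End ℂ V) V f) ^ N) v = 0 := by
    simpa [LieModule.toEnd_module_end] using hf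
  obtain ⟨n, hn₁, hn₂⟩ := Nat.exists_not_and_succ_of_not_zero_of_exists (p := fun N =>
    ((LieModule.toEnd ℂ (Module.End ℂ V) V f) ^ N) v = 0) P.ne_zero hf'
  refine ⟨n, ?_⟩
  -- The relation `e f^{n+1} v = (n+1)(μ - n) f^n v`, with `f^n v` the last nonzero power, forces `μ
  -- = n`. Only local nilpotency of `f` is needed, not finite dimension.
  have := P.lie_e_pow_succ_toEnd_f n
  rw [hn₂, lie_zero, eq_comm, smul_eq_zero_iff_left hn₁, mul_eq_zero, sub_eq_zero] at this
  exact this.resolve_left <| Nat.cast_add_one_ne_zero n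

/-- For an `sl₂`-triple of operators with `e` and `f` locally nilpotent, the eigenvalues of `h` are
integers and `f` is injective on the eigenspaces with positive eigenvalue. -/
theorem sl2_eigenvalue_int {h e f : Module.End ℂ V} (hef : ⁅e, f⁆ = h) (hhe : ⁅h, e⁆ = 2 • e)
    (hhf : ⁅h, f⁆ = -(2 • f)) (ne : ∀ v, ∃ N, (e ^ N) v = 0) (nf : ∀ v, ∃ N, (f ^ N) v = 0)
    {v : V} (hv : v ≠ 0) {μ : ℂ} (hμ : h v = μ • v) :
    ∃ p : ℤ, μ = p ∧ (0 < p → f v ≠ 0) := by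
  -- `IsSl2Triple` requires `h ≠ 0`; for `h = 0` the eigenvalue is `0` and the injectivity claim is
  -- vacuous.
  by_cases h0 : h = 0
  · refine ⟨0, ?_, fun h => absurd h (lt_irrefl 0)⟩
    rw [h0, LinearMap.zero_apply, eq_comm, smul_eq_zero_iff_left hv] at hμ
    simpa using hμ
  have t : IsSl2Triple h e f := ⟨h0, hef, hhe, hhf⟩
  have key : ∃ p : ℤ, μ = p := by
    -- The last nonzero `e^k v` is a primitive vector of weight `μ + 2k`, which is therefore a
    -- natural number.
    obtain ⟨k, hk₁, hk₂⟩ := Nat.exists_not_and_succ_of_not_zero_of_exists (p := fun N =>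
      (e ^ N) v = 0) hv (ne v)
    have hk := t.lie_h_pow_toEnd_e (R := ℂ) (m := v) (μ := μ) hμ k
    have he := IsSl2Triple.lie_e_pow_toEnd_e (R := ℂ) (m := v) (e := e) k
    simp only [LieModule.toEnd_module_end, LieHom.id_apply] at hk he
    obtain ⟨n, hn⟩ := eigenvalue_nat_of_primitive t ⟨hk₁, hk, he.trans hk₂⟩ (nf _)
    exact ⟨n - 2 * k, by push_cast; rw [← hn]; ring⟩
  obtain ⟨p, hp⟩ := key
  refine ⟨p, hp, fun h0 hfv => ?_⟩
  -- If `f v = 0`, then `v` is primitive for the opposite triple, so `-μ` is a natural number.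
  have P : t.symm.HasPrimitiveVectorWith v (-μ) := ⟨hv, by simp [hμ], hfv⟩
  obtain ⟨n, hn⟩ := eigenvalue_nat_of_primitive t.symm P (ne v)
  rw [hp] at hn
  have : -p = n := by exact_mod_cast hn
  omega

/-- For operators with `[a, b]` a nonzero scalar and an eigenvalue of `b a`, either all powers of
`a` or all powers of `b` are injective on the eigenspace. -/
theorem heisenberg_pow_ne_zero {a b : Module.End ℂ V} {κ : ℂ} (hκ : κ ≠ 0)
    (hab : a * b - b * a = κ • 1) (ρ : ℂ) :
    (∀ v, v ≠ 0 → b (a v) = ρ • v → ∀ j : ℕ, (a ^ j) v ≠ 0 ∧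
      b (a ((a ^ j) v)) = (ρ - j * κ) • (a ^ j) v) ∨
    (∀ v, v ≠ 0 → b (a v) = ρ • v → ∀ j : ℕ, (b ^ j) v ≠ 0 ∧
      b (a ((b ^ j) v)) = (ρ + j * κ) • (b ^ j) v) := by
  have hab' : ∀ w, a (b w) = b (a w) + κ • w := fun w => by
    have := LinearMap.congr_fun hab w
    simp only [LinearMap.sub_apply, Module.End.mul_apply, LinearMap.smul_apply,
      Module.End.one_apply] at this
    rw [← this]; abel
  -- `a b^{j+1} v = (ρ + (j+1)κ) b^j v` and `b a^{j+1} v = (ρ - jκ) a^j v`: the first scalar never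
  -- vanishes if `ρ ∈ ℕκ`, the second never vanishes otherwise. The branch depends on `ρ` alone, so
  -- it holds for all eigenvectors at once.
  by_cases hρ : ∃ k : ℕ, ρ = k * κ
  · right
    obtain ⟨k, hk⟩ := hρ
    intro v hv hva j
    induction j with
    | zero => simpa using ⟨hv, hva⟩
    | succ j ih =>
      have h1 : a ((b ^ (j + 1)) v) = (ρ + (j + 1 : ℕ) * κ) • (b ^ j) v := by
        rw [pow_succ', Module.End.mul_apply, hab', ih.2, ← add_smul]
        push_cast; congr 1; ring
      refine ⟨fun h0 => ?_, ?_⟩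
      · rw [h0, map_zero, eq_comm, smul_eq_zero_iff_left ih.1, hk, ← add_mul] at h1
        refine mul_ne_zero ?_ hκ h1
        exact_mod_cast (by omega : k + (j + 1) ≠ 0)
      · rw [h1, map_smul, pow_succ', Module.End.mul_apply]
  · left
    push Not at hρ
    intro v hv hva j
    induction j with
    | zero => simpa using ⟨hv, hva⟩
    | succ j ih =>
      refine ⟨fun h0 => ?_, ?_⟩
      · rw [pow_succ', Module.End.mul_apply] at h0
        have := ih.2
        rw [h0, map_zero, eq_comm, smul_eq_zero_iff_left ih.1, sub_eq_zero] at this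
        exact hρ j this
      · have h2 : b (a ((a ^ (j + 1)) v)) = a (b (a ((a ^ j) v))) - κ • (a ^ (j + 1)) v := by
          rw [hab', pow_succ', Module.End.mul_apply]; abel
        rw [h2, ih.2, map_smul, pow_succ', Module.End.mul_apply, ← sub_smul]
        push_cast; congr 1; ring

theorem apply_comm_of_commute {a b : Module.End ℂ V} (h : Commute a b) (v : V) :
    a (b v) = b (a v) := LinearMap.congr_fun h.eq v

theorem card_le_finrank_of_eigenvectors (T : Module.End ℂ V) (W : Submodule ℂ V)
    [FiniteDimensional ℂ W] (M : ℕ) (ρ : ℕ → ℂ) (hρ : Function.Injective ρ) (u : ℕ → V)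
    (hu : ∀ i ≤ M, u i ∈ W ∧ u i ≠ 0 ∧ T (u i) = ρ i • u i) :
    M + 1 ≤ Module.finrank ℂ W := by
  have hli : LinearIndependent ℂ (fun i : Fin (M + 1) => u i) :=
    Module.End.eigenvectors_linearIndependent' T (fun i : Fin (M + 1) => ρ i)
      (fun i j hij => Fin.ext (hρ hij)) _ fun i =>
        ⟨Module.End.mem_eigenspace_iff.mpr (hu i (by omega)).2.2, (hu i (by omega)).2.1⟩
  have h2 : LinearIndependent ℂ (fun i : Fin (M + 1) => (⟨u i, (hu i (by omega)).1⟩ : W)) :=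
    LinearIndependent.of_comp W.subtype hli
  simpa using h2.fintype_card_le_finrank

/-- A graded module over two Heisenberg pairs of degrees one and two has large graded pieces. -/
theorem heisenberg_growth {a b a' b' : Module.End ℂ V} {κ κ' : ℂ} (hκ : κ ≠ 0) (hκ' : κ' ≠ 0)
    (hab : a * b - b * a = κ • 1) (hab' : a' * b' - b' * a' = κ' • 1)
    (haa : Commute a a') (hbb : Commute b b') (hab2 : Commute a b') (hba2 : Commute b a')
    (W : ℤ → Submodule ℂ V) [∀ n, FiniteDimensional ℂ (W n)]
    (ha : ∀ n, ∀ v ∈ W n, a v ∈ W (n + 1)) (hb : ∀ n, ∀ v ∈ W n, b v ∈ W (n - 1))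
    (ha' : ∀ n, ∀ v ∈ W n, a' v ∈ W (n + 2)) (hb' : ∀ n, ∀ v ∈ W n, b' v ∈ W (n - 2))
    (n : ℤ) (hn : W n ≠ ⊥) (M : ℕ) :
    ∃ n', n - 2 * M ≤ n' ∧ M + 1 ≤ Module.finrank ℂ (W n') := by
  have pa : ∀ j : ℕ, ∀ n, ∀ v ∈ W n, (a ^ j) v ∈ W (n + j) := by
    intro j
    induction j with
    | zero => simp
    | succ j ih =>
      intro n v hv
      rw [pow_succ', Module.End.mul_apply]
      simpa [add_assoc] using ha _ _ (ih n v hv)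
  have pb : ∀ j : ℕ, ∀ n, ∀ v ∈ W n, (b ^ j) v ∈ W (n - j) := by
    intro j
    induction j with
    | zero => simp
    | succ j ih =>
      intro n v hv
      rw [pow_succ', Module.End.mul_apply]
      simpa [sub_sub] using hb _ _ (ih n v hv)
  have pa' : ∀ j : ℕ, ∀ n, ∀ v ∈ W n, (a' ^ j) v ∈ W (n + 2 * j) := by
    intro j
    induction j with
    | zero => simp
    | succ j ih =>
      intro n v hv
      rw [pow_succ', Module.End.mul_apply]
      have := ha' _ _ (ih n v hv)
      rwa [show n + 2 * (j : ℤ) + 2 = n + 2 * ((j + 1 : ℕ) : ℤ) by push_cast; ring] at this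
  have pb' : ∀ j : ℕ, ∀ n, ∀ v ∈ W n, (b' ^ j) v ∈ W (n - 2 * j) := by
    intro j
    induction j with
    | zero => simp
    | succ j ih =>
      intro n v hv
      rw [pow_succ', Module.End.mul_apply]
      have := hb' _ _ (ih n v hv)
      rwa [show n - 2 * (j : ℤ) - 2 = n - 2 * ((j + 1 : ℕ) : ℤ) by push_cast; ring] at this
  have hcomm : Commute (b * a) (b' * a') :=
    (hbb.mul_right hba2).mul_left (hab2.mul_right haa)
  -- a common eigenvector of `b * a` and `b' * a'`
  obtain ⟨v, hvW, hv0, ρ, hvρ, ρ', hvρ'⟩ : ∃ v ∈ W n, v ≠ 0 ∧ ∃ ρ : ℂ, b (a v) = ρ • v ∧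
      ∃ ρ' : ℂ, b' (a' v) = ρ' • v := by
    have m1 : ∀ v ∈ W n, (b * a) v ∈ W n := fun v hv => by simpa using hb _ _ (ha _ _ hv)
    have m2 : ∀ v ∈ W n, (b' * a') v ∈ W n := fun v hv => by simpa using hb' _ _ (ha' _ _ hv)
    have : Nontrivial (W n) := Submodule.nontrivial_iff_ne_bot.mpr hn
    obtain ⟨ρ, hρ⟩ := Module.End.exists_eigenvalue ((b * a).restrict m1)
    set E : Submodule ℂ V := W n ⊓ Module.End.eigenspace (b * a) ρ with hE
    have hE0 : Nontrivial E := by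
      obtain ⟨w, hw⟩ := hρ.exists_hasEigenvector
      refine Submodule.nontrivial_iff_ne_bot.mpr fun h => hw.2 ?_
      have : (w : V) ∈ E := ⟨w.2, Module.End.mem_eigenspace_iff.mpr
        (congrArg Subtype.val hw.apply_eq_smul)⟩
      rw [h, Submodule.mem_bot] at this
      exact Subtype.ext this
    have : FiniteDimensional ℂ E := Submodule.finiteDimensional_of_le inf_le_left
    have m3 : ∀ v ∈ E, (b' * a') v ∈ E := fun v hv => by
      refine ⟨m2 v hv.1, Module.End.mem_eigenspace_iff.mpr ?_⟩
      rw [apply_comm_of_commute hcomm, Module.End.mem_eigenspace_iff.mp hv.2, map_smul]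
    obtain ⟨ρ', hρ'⟩ := Module.End.exists_eigenvalue ((b' * a').restrict m3)
    obtain ⟨w, hw⟩ := hρ'.exists_hasEigenvector
    exact ⟨w, w.2.1, fun h => hw.2 (Subtype.ext h), ρ, Module.End.mem_eigenspace_iff.mp w.2.2, ρ',
      congrArg Subtype.val hw.apply_eq_smul⟩
  have e1 : ∀ (s : Module.End ℂ V), Commute (b' * a') s → ∀ i : ℕ,
      b' (a' ((s ^ i) v)) = ρ' • (s ^ i) v := fun s hs i => by
    have := apply_comm_of_commute (hs.pow_right i) v
    simp only [Module.End.mul_apply] at this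
    rw [this, hvρ', map_smul]
  have e2 : ∀ (s : Module.End ℂ V), Commute (b * a) s → ∀ (i : ℕ) (w : V) (r : ℂ),
      b (a w) = r • w → b (a ((s ^ i) w)) = r • (s ^ i) w := fun s hs i w r hw => by
    have := apply_comm_of_commute (hs.pow_right i) w
    simp only [Module.End.mul_apply] at this
    rw [this, hw, map_smul]
  have ca : Commute (b' * a') a := (hab2.symm).mul_left haa.symm
  have cb : Commute (b' * a') b := (hbb.symm).mul_left hba2.symm
  have ca' : Commute (b * a) a' := hba2.mul_left haa
  have cb' : Commute (b * a) b' := hbb.mul_left hab2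
  have i1 : ∀ m : ℂ, m ≠ 0 → Function.Injective fun i : ℕ => ρ + m * (i * κ) :=
    fun m hm i j hij => by simpa [hm, hκ] using hij
  -- In each case, `2i` steps of degree one are balanced against `i` or `M - i` steps of degree two
  -- so that the final degree does not depend on `i`: it is `n + 2M`, `n`, `n` or `n - 2M`. The
  -- resulting `M + 1` vectors have distinct eigenvalues `ρ ± 2iκ` of `b * a`, since the second pair
  -- commutes with the first.
  rcases heisenberg_pow_ne_zero hκ hab ρ with h1 | h1 <;>
    rcases heisenberg_pow_ne_zero hκ' hab' ρ' with h2 | h2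
  · refine ⟨n + 2 * M, by omega, card_le_finrank_of_eigenvectors (b * a) _ M _
      (i1 (-2) (by norm_num)) (fun i => (a' ^ (M - i)) ((a ^ (2 * i)) v)) fun i hi => ⟨?_, ?_, ?_⟩⟩
    · have := pa' (M - i) _ _ (pa (2 * i) n v hvW)
      convert this using 2; omega
    · exact (h2 _ (h1 v hv0 hvρ _).1 (e1 a ca _) _).1
    · refine (e2 a' ca' _ _ _ (h1 v hv0 hvρ (2 * i)).2).trans ?_
      push_cast; congr 1; ring
  · refine ⟨n, by omega, card_le_finrank_of_eigenvectors (b * a) _ M _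
      (i1 (-2) (by norm_num)) (fun i => (b' ^ i) ((a ^ (2 * i)) v)) fun i hi => ⟨?_, ?_, ?_⟩⟩
    · have := pb' i _ _ (pa (2 * i) n v hvW)
      convert this using 2; push_cast; ring
    · exact (h2 _ (h1 v hv0 hvρ _).1 (e1 a ca _) _).1
    · refine (e2 b' cb' _ _ _ (h1 v hv0 hvρ (2 * i)).2).trans ?_
      push_cast; congr 1; ring
  · refine ⟨n, by omega, card_le_finrank_of_eigenvectors (b * a) _ M _
      (i1 2 (by norm_num)) (fun i => (a' ^ i) ((b ^ (2 * i)) v)) fun i hi => ⟨?_, ?_, ?_⟩⟩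
    · have := pa' i _ _ (pb (2 * i) n v hvW)
      convert this using 2; push_cast; ring
    · exact (h2 _ (h1 v hv0 hvρ _).1 (e1 b cb _) _).1
    · refine (e2 a' ca' _ _ _ (h1 v hv0 hvρ (2 * i)).2).trans ?_
      push_cast; congr 1; ring
  · refine ⟨n - 2 * M, by omega, card_le_finrank_of_eigenvectors (b * a) _ M _
      (i1 2 (by norm_num)) (fun i => (b' ^ (M - i)) ((b ^ (2 * i)) v)) fun i hi => ⟨?_, ?_, ?_⟩⟩
    · have := pb' (M - i) _ _ (pb (2 * i) n v hvW)
      convert this using 2; omega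
    · exact (h2 _ (h1 v hv0 hvρ _).1 (e1 b cb _) _).1
    · refine (e2 b' cb' _ _ _ (h1 v hv0 hvρ (2 * i)).2).trans ?_
      push_cast; congr 1; ring

end Operators

variable {𝔤 : Type*} [LieRing 𝔤] [LieAlgebra ℂ 𝔤]

open LieAlgebra

/-! ### Roots of `𝔤` -/

section Roots

theorem mem_rootSpace_zero [FiniteDimensional ℂ 𝔤] {H : LieSubalgebra ℂ 𝔤}
    [H.IsCartanSubalgebra] (h : H) : (h : 𝔤) ∈ rootSpace H (0 : H → ℂ) := by
  rw [rootSpace_zero_eq]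
  exact h.2

variable [LieAlgebra.IsKilling ℂ 𝔤] [FiniteDimensional ℂ 𝔤] {H : LieSubalgebra ℂ 𝔤}
  [H.IsCartanSubalgebra]

open LieAlgebra.IsKilling LieModule

/-- The value of `Φ.form e f` comes from invariance: `⟨[e, f], α^∨⟩ = 2 ⟨e, f⟩`. It determines the
central term in the affine `sl₂`-triples. -/
theorem exists_root_sl2 (Φ : InvForm 𝔤) (α : H.root) :
    ∃ e ∈ rootSpace H α.1, ∃ f ∈ rootSpace H (-(α.1 : H → ℂ)), ⁅e, f⁆ = (coroot α.1 : 𝔤) ∧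
      ⁅(coroot α.1 : 𝔤), e⁆ = 2 • e ∧ ⁅(coroot α.1 : 𝔤), f⁆ = -(2 • f) ∧
      Φ.form e f = Φ.form (coroot α.1) (coroot α.1) / 2 := by
  have hα := H.isNonZero_coe_root α
  obtain ⟨h, e, f, t, he, hf⟩ := exists_isSl2Triple_of_weight_isNonZero hα
  obtain rfl := t.h_eq_coroot hα he hf
  refine ⟨e, he, f, hf, t.lie_e_f, t.lie_h_e_nsmul, t.lie_h_f_nsmul, ?_⟩
  have h1 := Φ.invariant e f (coroot α.1)
  rw [t.lie_e_f, ← lie_skew, t.lie_h_e_nsmul, map_neg, neg_neg, map_nsmul, Φ.symm.eq f e] at h1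
  rw [h1]
  simp

theorem dual_eq_of_coroot {x y : Module.Dual ℂ H}
    (h : ∀ α : H.root, x (coroot α.1) = y (coroot α.1)) : x = y := by
  refine LinearMap.ext_on (s := Set.range (rootSystem H).coroot)
    RootPairing.IsRootSystem.span_coroot_eq_top ?_
  rintro _ ⟨α, rfl⟩
  exact h α

/-- The coroots span `H`, so a weight is determined by its values on them. -/
theorem finite_bounded_integral_weights (M : ℤ) :
    {x : Module.Dual ℂ H | ∀ α : H.root, ∃ p : ℤ, x (coroot α.1) = p ∧ -M ≤ p ∧ p ≤ M}.Finite := by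
  have h1 : (Set.pi Set.univ fun _ : H.root => (Int.cast '' Set.Icc (-M) M : Set ℂ)).Finite :=
    Set.Finite.pi fun _ => (Set.finite_Icc _ _).image _
  refine (h1.preimage (f := fun (x : Module.Dual ℂ H) (α : H.root) => x (coroot α.1)) ?_).subset ?_
  · exact fun x _ y _ hxy => dual_eq_of_coroot fun α => congrFun hxy α
  · intro x hx α _
    obtain ⟨p, hp, h1, h2⟩ := hx α
    exact ⟨p, ⟨h1, h2⟩, hp.symm⟩

/-- The root form is the sum of the squares `x (α^∨)²`. Being a natural number, it can serve as a
measure for descent. -/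
theorem rootForm_natural {x : Module.Dual ℂ H} (hx : ∀ α : H.root, ∃ p : ℤ, x (coroot α.1) = p) :
    ∃ N : ℕ, (rootSystem H).RootForm x x = N ∧ ((∃ α : H.root, x (coroot α.1) ≠ 0) → 0 < N) := by
  choose p hp using hx
  refine ⟨∑ α, (p α).natAbs ^ 2, ?_, fun ⟨α, hα⟩ => ?_⟩
  · rw [RootPairing.rootForm_apply_apply]
    push_cast
    refine Finset.sum_congr rfl fun α _ => ?_
    change x (coroot α.1) * x (coroot α.1) = _
    rw [hp]
    have : ((p α).natAbs ^ 2 : ℤ) = p α * p α := by rw [pow_two, Int.natAbs_mul_self']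
    rw [← Int.cast_mul, ← this, Int.cast_pow, Int.cast_natCast]
  · refine Finset.sum_pos' (fun _ _ => Nat.zero_le _) ⟨α, Finset.mem_univ _, ?_⟩
    have : p α ≠ 0 := fun h => hα (by rw [hp, h, Int.cast_zero])
    positivity

theorem root_apply_coroot_int (α β : H.root) : ∃ p : ℤ, α.1 (coroot β.1) = p :=
  ⟨_, apply_coroot_eq_cast β.1 α.1⟩

/-- Reflection invariance of the root form gives `2 (x, α) = x (α^∨) (α, α)`. -/
theorem rootForm_sub_root (x : Module.Dual ℂ H) (α : H.root) :
    (rootSystem H).RootForm (x - (rootSystem H).root α) (x - (rootSystem H).root α) =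
      (rootSystem H).RootForm x x -
      (x (coroot α.1) - 1) * (rootSystem H).RootForm ((rootSystem H).root α)
        ((rootSystem H).root α) := by
  have h1 := (rootSystem H).rootForm_reflection_reflection_apply α x ((rootSystem H).root α)
  rw [RootPairing.reflection_apply_self, RootPairing.reflection_apply] at h1
  have h3 : (rootSystem H).coroot' α x = x (coroot α.1) := rfl
  have h2 := (rootSystem H).rootForm_symmetric.eq ((rootSystem H).root α) x
  simp only [RingHom.id_apply] at h2
  rw [h3] at h1
  simp only [map_sub, map_neg, LinearMap.sub_apply, map_smul, LinearMap.smul_apply, smul_eq_mul]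
    at h1 ⊢
  linear_combination h1 - h2

end Roots

/-! ### Weight-graded representations of the affine algebra -/

/-- A representation of the affine algebra `𝔤 ⊗ ℂ[t, t⁻¹] ⊕ ℂ K`, with `K` acting by the scalar
`level`, together with compatible finite-dimensional weight pieces `W λ n`, such that the real root
vectors act locally nilpotently. -/
structure AffRep (Φ : InvForm 𝔤) (H : LieSubalgebra ℂ 𝔤) [LieRing.IsNilpotent H]
    (V : Type*) [AddCommGroup V] [Module ℂ V] where
  X : ℤ → 𝔤 →ₗ[ℂ] Module.End ℂ V
  level : ℂ
  W : Module.Dual ℂ H → ℤ → Submodule ℂ V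
  comm : ∀ n m y z, X n y * X m z - X m z * X n y =
    X (n + m) ⁅y, z⁆ + ((if m = -n then (n : ℂ) * Φ.form y z else 0) * level) • 1
  weight : ∀ l n, ∀ v ∈ W l n, ∀ h : H, X 0 h v = l h • v
  maps : ∀ l n k (χ : Module.Dual ℂ H), ∀ y ∈ rootSpace H (χ : H → ℂ), ∀ v ∈ W l n,
    X k y v ∈ W (l + χ) (n + k)
  finiteDimensional : ∀ l n, FiniteDimensional ℂ (W l n)
  nilpotent : ∀ (χ : LieModule.Weight ℂ H 𝔤), χ.IsNonZero → ∀ k, ∀ y ∈ rootSpace H χ, ∀ v,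
    ∃ N, (X k y ^ N) v = 0

namespace AffRep

variable {Φ : InvForm 𝔤} {H : LieSubalgebra ℂ 𝔤} {V : Type*} [AddCommGroup V] [Module ℂ V]

/-- The twist of a representation by `t ↦ t⁻¹`. -/
def flip [LieRing.IsNilpotent H] (ρ : AffRep Φ H V) : AffRep Φ H V where
  X n := ρ.X (-n)
  level := -ρ.level
  W l n := ρ.W l (-n)
  comm n m y z := by
    rw [ρ.comm, neg_add]
    congr 2
    by_cases h : m = -n
    · subst h; simp
    · rw [if_neg h, if_neg (by omega)]; simp
  weight l n v hv h := by rw [neg_zero]; exact ρ.weight l _ v hv h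
  maps l n k χ y hy v hv := by rw [neg_add]; exact ρ.maps l _ _ χ y hy v hv
  finiteDimensional l n := ρ.finiteDimensional l _
  nilpotent χ hχ k := ρ.nilpotent χ hχ _

/-- The operators of `h ⊗ tⁿ` generate a Heisenberg algebra with commutators `n ⟨h, h⟩ level`. A
nonzero piece in degree `n ≥ N + 2D` would produce one of dimension at least `D + 1` in a degree
still at least `N`. -/
theorem eq_bot_of_finrank_bounded [FiniteDimensional ℂ 𝔤] [H.IsCartanSubalgebra]
    (ρ : AffRep Φ H V) (hlevel : ρ.level ≠ 0) {h : H} (hh : Φ.form h h ≠ 0)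
    (l : Module.Dual ℂ H) (N : ℤ) (D : ℕ) (hD : ∀ n, N ≤ n → Module.finrank ℂ (ρ.W l n) ≤ D)
    (n : ℤ) (hn : N + 2 * D ≤ n) : ρ.W l n = ⊥ := by
  by_contra hne
  have := ρ.finiteDimensional
  have hz : ⁅(h : 𝔤), (h : 𝔤)⁆ = 0 := lie_self _
  have cm : ∀ n m : ℤ, m ≠ -n → Commute (ρ.X n h) (ρ.X m h) := fun n m hnm => by
    have := ρ.comm n m h h
    rw [hz, map_zero, if_neg hnm, zero_mul, zero_smul, zero_add, sub_eq_zero] at this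
    exact this
  have hmaps : ∀ k n : ℤ, ∀ v ∈ ρ.W l n, ρ.X k h v ∈ ρ.W l (n + k) := fun k n v hv => by
    have := ρ.maps l n k 0 h (mem_rootSpace_zero h) v hv
    rwa [add_zero] at this
  obtain ⟨n', h1, h2⟩ := heisenberg_growth (a := ρ.X 1 h) (b := ρ.X (-1) h) (a' := ρ.X 2 h)
    (b' := ρ.X (-2) h) (κ := Φ.form h h * ρ.level) (κ' := 2 * Φ.form h h * ρ.level)
    (mul_ne_zero hh hlevel) (mul_ne_zero (mul_ne_zero two_ne_zero hh) hlevel)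
    (by rw [ρ.comm, hz, map_zero, if_pos rfl, zero_add, Int.cast_one, one_mul])
    (by rw [ρ.comm, hz, map_zero, if_pos rfl, zero_add, Int.cast_ofNat])
    (cm _ _ (by omega)) (cm _ _ (by omega)) (cm _ _ (by omega)) (cm _ _ (by omega))
    (fun n => ρ.W l n) (hmaps 1) (hmaps (-1)) (hmaps 2) (hmaps (-2)) n hne D
  have := hD n' (by omega)
  omega

variable [LieAlgebra.IsKilling ℂ 𝔤] [FiniteDimensional ℂ 𝔤] [H.IsCartanSubalgebra]

open LieAlgebra.IsKilling LieModule

/-- The triple is `(α^∨ + s, e ⊗ t^k, f ⊗ t^{-k})`, where the scalar `s` is the central term of the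
bracket `[e ⊗ t^k, f ⊗ t^{-k}]`. One `f` serves every `k`. -/
theorem exists_lowering (ρ : AffRep Φ H V) (α : H.root) :
    ∃ f ∈ rootSpace H (-(α.1 : H → ℂ)), ∀ (k : ℤ) l n, ∀ v ∈ ρ.W l n, v ≠ 0 →
      ∃ p : ℤ, l (coroot α.1) + k * (ρ.level * (Φ.form (coroot α.1) (coroot α.1) / 2)) = p ∧
        (0 < p → ρ.X (-k) f v ≠ 0) := by
  obtain ⟨e, he, f, hf, hef, hhe, hhf, hΦ⟩ := exists_root_sl2 Φ α
  refine ⟨f, hf, fun k l n v hv hv0 => ?_⟩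
  let _ := LieRing.ofAssociativeRing (A := Module.End ℂ V)
  set s : ℂ := k * (ρ.level * (Φ.form (coroot α.1) (coroot α.1) / 2)) with hs
  have h0 : ∀ k' : ℤ, ∀ y : 𝔤, (ρ.X 0 (coroot α.1) + s • 1) * ρ.X k' y -
      ρ.X k' y * (ρ.X 0 (coroot α.1) + s • 1) = ρ.X k' ⁅(coroot α.1 : 𝔤), y⁆ := fun k' y => by
    have := ρ.comm 0 k' (coroot α.1) y
    simp only [Int.cast_zero, zero_mul, ite_self, zero_smul, add_zero, zero_add] at this
    rw [← this, add_mul, mul_add, smul_one_mul, mul_smul_one]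
    abel
  refine sl2_eigenvalue_int (h := ρ.X 0 (coroot α.1) + s • 1) (e := ρ.X k e) (f := ρ.X (-k) f)
    ?_ ?_ ?_ (ρ.nilpotent α.1 (H.isNonZero_coe_root α) k e he)
    (ρ.nilpotent (-α.1) (H.isNonZero_coe_root α).neg _ f (by simpa using hf)) hv0 ?_
  · rw [LieRing.of_associative_ring_bracket, ρ.comm, hef, if_pos rfl, add_neg_cancel, hΦ]
    congr 2
    rw [hs]; ring
  · rw [LieRing.of_associative_ring_bracket, h0, hhe, map_nsmul]
  · rw [LieRing.of_associative_ring_bracket, h0, hhf, map_neg, map_nsmul]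
  · rw [LinearMap.add_apply, ρ.weight l n v hv, LinearMap.smul_apply, Module.End.one_apply,
      ← add_smul]

/-- The level of `ρ` is positive: the numbers `level * ⟨α^∨, α^∨⟩ / 2` are the positive integers
`q α`. -/
def IsPositive (ρ : AffRep Φ H V) (q : H.root → ℤ) : Prop :=
  ∀ α : H.root, ρ.level * (Φ.form (coroot α.1) (coroot α.1) / 2) = q α ∧ 0 < q α

variable (ρ : AffRep Φ H V)

theorem exists_int_of_ne_bot {l : Module.Dual ℂ H} {n : ℤ} (h : ρ.W l n ≠ ⊥) (α : H.root) :
    ∃ p : ℤ, l (coroot α.1) = p := by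
  obtain ⟨v, hv, hv0⟩ := Submodule.exists_mem_ne_zero_of_ne_bot h
  obtain ⟨f, -, hf⟩ := ρ.exists_lowering α
  obtain ⟨p, hp, -⟩ := hf 0 l n v hv hv0
  exact ⟨p, by simpa using hp⟩

/-- This number is the difference of the `sl₂`-eigenvalues for `k = 1` and `k = 0` on one weight
vector. -/
theorem exists_int_level {l : Module.Dual ℂ H} {n : ℤ} (h : ρ.W l n ≠ ⊥) (α : H.root) :
    ∃ q : ℤ, ρ.level * (Φ.form (coroot α.1) (coroot α.1) / 2) = q := by
  obtain ⟨v, hv, hv0⟩ := Submodule.exists_mem_ne_zero_of_ne_bot h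
  obtain ⟨f, -, hf⟩ := ρ.exists_lowering α
  obtain ⟨p, hp, -⟩ := hf 0 l n v hv hv0
  obtain ⟨p', hp', -⟩ := hf 1 l n v hv hv0
  exact ⟨p' - p, by push_cast; rw [← hp, ← hp']; push_cast; ring⟩

/-- The root `-α`. -/
def negRoot (α : H.root) : H.root := ⟨-α.1, by simpa using H.isNonZero_coe_root α⟩

theorem root_negRoot (α : H.root) :
    (rootSystem H).root (negRoot α) = -(rootSystem H).root α := rfl

variable {ρ} {q : H.root → ℤ}

theorem IsPositive.negRoot (hq : ρ.IsPositive q) (α : H.root) : q (negRoot α) = q α := by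
  have h1 := (hq (AffRep.negRoot α)).1
  rw [AffRep.negRoot] at h1
  simp only [coroot_neg, NegMemClass.coe_neg, map_neg, LinearMap.neg_apply, neg_neg] at h1
  rw [(hq α).1] at h1
  exact_mod_cast h1.symm

/-- Lowering operators of `𝔰𝔩₂` for the affine root `α + k δ` are injective on weight spaces of
positive weight. -/
theorem IsPositive.exists_lowering (hq : ρ.IsPositive q) (α : H.root) :
    ∃ f ∈ rootSpace H (-(α.1 : H → ℂ)), ∀ (k : ℤ) (l : Module.Dual ℂ H) n (p : ℤ), l (coroot α.1) = p →
      0 < p + k * q α → (∀ v ∈ ρ.W l n, ρ.X (-k) f v ∈ ρ.W (l - (rootSystem H).root α) (n - k)) ∧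
        ∀ v ∈ ρ.W l n, ρ.X (-k) f v = 0 → v = 0 := by
  obtain ⟨f, hf, h⟩ := ρ.exists_lowering α
  refine ⟨f, hf, fun k l n p hp hpos => ⟨fun v hv => ?_, fun v hv hfv => ?_⟩⟩
  · have := ρ.maps l n (-k) (-(rootSystem H).root α) f hf v hv
    rwa [← sub_eq_add_neg, ← sub_eq_add_neg] at this
  · by_contra hv0
    obtain ⟨p', hp', h'⟩ := h k l n v hv hv0
    rw [(hq α).1, hp] at hp'
    have : p + k * q α = p' := by exact_mod_cast hp'
    exact h' (this ▸ hpos) hfv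

theorem finrank_le_of_injOn {V : Type*} [AddCommGroup V] [Module ℂ V] {W W' : Submodule ℂ V}
    [FiniteDimensional ℂ W'] (T : Module.End ℂ V) (h : ∀ v ∈ W, T v ∈ W')
    (h' : ∀ v ∈ W, T v = 0 → v = 0) : Module.finrank ℂ W ≤ Module.finrank ℂ W' :=
  LinearMap.finrank_le_finrank_of_injective (f := T.restrict h) <| by
    rw [← LinearMap.ker_eq_bot, LinearMap.ker_eq_bot']
    exact fun v hv => Subtype.ext (h' v v.2 (congrArg Subtype.val hv))

/-- Lowering along `α + kδ` and then along `-α + (m - k)δ` returns to the weight `l`, with the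
degree reduced by `m`. Both maps are injective when `k` and `m - k` are large. -/
theorem IsPositive.finrank_le (hq : ρ.IsPositive q) [Nonempty H.root] (l : Module.Dual ℂ H)
    (hl : ∀ α : H.root, ∃ p : ℤ, l (coroot α.1) = p) :
    ∃ m₀ : ℤ, ∀ n m : ℤ, m₀ ≤ m →
      Module.finrank ℂ (ρ.W l n) ≤ Module.finrank ℂ (ρ.W l (n - m)) := by
  obtain ⟨α⟩ := ‹Nonempty H.root›
  obtain ⟨p, hp⟩ := hl α
  have h2 : (rootSystem H).root α (coroot α.1) = 2 :=
    root_apply_coroot (H.isNonZero_coe_root α)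
  obtain ⟨f, -, hf⟩ := hq.exists_lowering α
  obtain ⟨g, -, hg⟩ := hq.exists_lowering (AffRep.negRoot α)
  have hα := (hq α).2
  have := ρ.finiteDimensional
  -- The two pairings are `p` and `-(p - 2)`. Since `q α ≥ 1`, adding `k q α` with `k ≥ |p| + 3`
  -- makes either one positive.
  refine ⟨2 * (|p| + 3), fun n m hm => ?_⟩
  have hpos : ∀ k, |p| + 3 ≤ k → |p| + 3 ≤ k * q α := fun k hk => by
    have : 0 ≤ |p| := abs_nonneg p
    nlinarith
  have a1 := neg_abs_le p
  have a2 := le_abs_self p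
  set k := |p| + 3 with hk
  have f1 := hf k l n p hp (by have := hpos k le_rfl; omega)
  have g1 := hg (m - k) (l - (rootSystem H).root α) (n - k) (-(p - 2)) (by
      simp only [AffRep.negRoot, coroot_neg, map_neg, LinearMap.sub_apply, hp, h2]; push_cast; ring)
    (by rw [hq.negRoot]; have := hpos (m - k) (by omega); omega)
  refine (finrank_le_of_injOn _ f1.1 f1.2).trans ((finrank_le_of_injOn _ g1.1 g1.2).trans_eq ?_)
  rw [root_negRoot, sub_neg_eq_add, sub_add_cancel, show n - k - (m - k) = n - m by ring]

/-- For integral `l`, every dimension in degrees from `m₀` on is at most that of `W l 0`, which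
Heisenberg growth forbids for nonzero pieces far out. For other `l` all pieces vanish. -/
theorem IsPositive.eventually_bot (hq : ρ.IsPositive q) [Nonempty H.root] (l : Module.Dual ℂ H) :
    ∃ N : ℤ, ∀ n, N ≤ n → ρ.W l n = ⊥ := by
  by_cases hl : ∀ α : H.root, ∃ p : ℤ, l (coroot α.1) = p
  · obtain ⟨m₀, hm⟩ := hq.finrank_le l hl
    obtain ⟨α⟩ := ‹Nonempty H.root›
    have hα : ρ.level * (Φ.form (coroot α.1) (coroot α.1) / 2) ≠ 0 := by
      rw [(hq α).1]; exact_mod_cast (hq α).2.ne'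
    refine ⟨_, ρ.eq_bot_of_finrank_bounded (left_ne_zero_of_mul hα) (h := coroot α.1) (fun h => hα ?_)
      l m₀ (Module.finrank ℂ (ρ.W l 0)) fun n hn => ?_⟩
    · rw [h]; simp
    · exact (hm n n hn).trans_eq (by rw [sub_self])
  · refine ⟨0, fun n _ => ?_⟩
    by_contra h
    exact hl (ρ.exists_int_of_ne_bot h)

/-- The affine root `α - δ` has pairing `p - q α > 0`, so its lowering operator, which has degree
`+1`, is injective. -/
theorem IsPositive.sub_root_ne_bot (hq : ρ.IsPositive q) {l : Module.Dual ℂ H} {n : ℤ} (h : ρ.W l n ≠ ⊥)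
    (α : H.root) {p : ℤ} (hp : l (coroot α.1) = p) (hpq : q α < p) :
    ρ.W (l - (rootSystem H).root α) (n + 1) ≠ ⊥ := by
  obtain ⟨v, hv, hv0⟩ := Submodule.exists_mem_ne_zero_of_ne_bot h
  obtain ⟨f, -, hf⟩ := hq.exists_lowering α
  obtain ⟨h1, h2⟩ := hf (-1) l n p hp (by omega)
  exact fun hbot => hv0 (h2 v hv (by have := h1 v hv; rwa [sub_neg_eq_add, hbot] at this))

/-- While some `l (α^∨)` exceeds `q α`, replacing `l` by `l - α` raises the degree and shortens the
weight. The induction is on the squared length. -/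
theorem IsPositive.exists_bounded (hq : ρ.IsPositive q) (M : ℤ) (hM : ∀ α, q α ≤ M) (N : ℕ)
    (l : Module.Dual ℂ H) (n : ℤ) (h : ρ.W l n ≠ ⊥) (hN : (rootSystem H).RootForm l l = N) :
    ∃ l' n', ρ.W l' n' ≠ ⊥ ∧ n ≤ n' ∧
      ∀ α : H.root, ∃ p : ℤ, l' (coroot α.1) = p ∧ -M ≤ p ∧ p ≤ M := by
  induction N using Nat.strong_induction_on generalizing l n with
  | _ N ih =>
    by_cases hex : ∃ α : H.root, ∃ p : ℤ, l (coroot α.1) = p ∧ q α < p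
    · obtain ⟨α, p, hp, hpq⟩ := hex
      have h' := hq.sub_root_ne_bot h α hp hpq
      obtain ⟨N', hN', -⟩ := rootForm_natural (ρ.exists_int_of_ne_bot h')
      obtain ⟨r, hr, hr0⟩ := rootForm_natural (x := (rootSystem H).root α)
        (fun β => root_apply_coroot_int α β)
      have hr0 : 0 < r := hr0 ⟨α, by
        have : (rootSystem H).root α (coroot α.1) = 2 := root_apply_coroot (H.isNonZero_coe_root α)
        rw [this]; norm_num⟩
      have key := rootForm_sub_root l α
      rw [hN', hN, hr, hp] at key
      have key : (N' : ℤ) = N - (p - 1) * r := by exact_mod_cast key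
      -- Here `p > q α ≥ 1`, so `(p - 1) r` is positive.
      have hlt : N' < N := by
        have := (hq α).2
        zify at hr0 ⊢
        nlinarith
      obtain ⟨l', n', h1, h2, h3⟩ := ih N' hlt _ _ h' hN'
      exact ⟨l', n', h1, by omega, h3⟩
    · push Not at hex
      refine ⟨l, n, h, le_rfl, fun α => ?_⟩
      obtain ⟨p, hp⟩ := ρ.exists_int_of_ne_bot h α
      refine ⟨p, hp, ?_, (hex α p hp).trans (hM α)⟩
      have := (hex (AffRep.negRoot α) (-p) (by simp [AffRep.negRoot, hp])).trans (hM _)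
      omega

/-- A representation of positive level has a largest degree, and finitely many weights in this
degree. -/
theorem IsPositive.exists_greatest (hq : ρ.IsPositive q) [Nonempty H.root]
    (hne : ∃ l n, ρ.W l n ≠ ⊥) :
    ∃ n, (∃ l, ρ.W l n ≠ ⊥) ∧ (∀ l n', n < n' → ρ.W l n' = ⊥) ∧ {l | ρ.W l n ≠ ⊥}.Finite := by
  obtain ⟨M, hM⟩ : ∃ M, ∀ α, q α ≤ M := by
    obtain ⟨M, hM⟩ := (Set.finite_range q).bddAbove
    exact ⟨M, fun α => hM ⟨α, rfl⟩⟩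
  choose N hN using hq.eventually_bot
  have hfin := finite_bounded_integral_weights (H := H) M
  obtain ⟨B, hB⟩ := (hfin.image N).bddAbove
  obtain ⟨n, ⟨l, hl⟩, hmax⟩ := Int.exists_greatest_of_bdd (P := fun n => ∃ l, ρ.W l n ≠ ⊥)
    ⟨B, fun n ⟨l, hl⟩ => by
      obtain ⟨N₀, hN₀, -⟩ := rootForm_natural (ρ.exists_int_of_ne_bot hl)
      obtain ⟨l', n', h1, h2, h3⟩ := hq.exists_bounded M hM N₀ l n hl hN₀
      -- The weight `l'` lies in the finite set of bounded weights, so the vanishing thresholds `N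
      -- l'` have a common bound `B`.
      have h4 : n' < N l' := by
        by_contra hlt
        exact h1 (hN l' n' (not_lt.mp hlt))
      have h5 : N l' ≤ B := hB ⟨l', h3, rfl⟩
      omega⟩ (by obtain ⟨l, n, h⟩ := hne; exact ⟨n, l, h⟩)
  refine ⟨n, ⟨l, hl⟩, fun l n' hn => ?_, hfin.subset fun l hl α => ?_⟩
  · by_contra h
    have := hmax n' ⟨l, h⟩
    omega
  · have key : ∀ α : H.root, ∀ p : ℤ, l (coroot α.1) = p → p ≤ q α := fun α p hp => by
      by_contra hlt
      have := hmax _ ⟨_, hq.sub_root_ne_bot hl α hp (not_le.mp hlt)⟩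
      omega
    obtain ⟨p, hp⟩ := ρ.exists_int_of_ne_bot hl α
    refine ⟨p, hp, ?_, (key α p hp).trans (hM α)⟩
    have := (key (AffRep.negRoot α) (-p) (by simp [AffRep.negRoot, hp])).trans (hM _)
    omega

end AffRep

/-! ### Simple Lie algebras: proportionality of invariant forms -/

section Simple

open LieAlgebra.IsKilling LieModule

theorem nontrivial_of_isSimple [LieAlgebra.IsSimple ℂ 𝔤] : Nontrivial 𝔤 := by
  rw [← not_subsingleton_iff_nontrivial]
  exact fun h => IsSimple.non_abelian ℂ (L := 𝔤) ⟨fun _ _ => Subsingleton.elim _ _⟩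

variable [FiniteDimensional ℂ 𝔤] [LieAlgebra.IsSimple ℂ 𝔤]

/-- A Schur argument: `T` represents `Φ.form` by the Killing form `κ`. For an eigenvalue `s` of `T`,
the radical of `Φ.form - s κ` is an ideal containing an eigenvector, hence is all of `𝔤`. -/
theorem InvForm.exists_eq_smul_killingForm (Φ : InvForm 𝔤) :
    ∃ s : ℂ, s ≠ 0 ∧ ∀ x y, Φ.form x y = s * killingForm ℂ 𝔤 x y := by
  have hκ : (killingForm ℂ 𝔤).Nondegenerate := LieAlgebra.IsKilling.killingForm_nondegenerate ℂ 𝔤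
  have := nontrivial_of_isSimple (𝔤 := 𝔤)
  let T : Module.End ℂ 𝔤 :=
    ((LinearMap.BilinForm.toDual (killingForm ℂ 𝔤) hκ).symm : Module.Dual ℂ 𝔤 →ₗ[ℂ] 𝔤) ∘ₗ Φ.form
  have hT : ∀ x y, killingForm ℂ 𝔤 (T x) y = Φ.form x y := fun x y =>
    LinearMap.BilinForm.apply_toDual_symm_apply (hB := hκ) ..
  obtain ⟨s, hs⟩ := Module.End.exists_eigenvalue T
  obtain ⟨v, hv⟩ := hs.exists_hasEigenvector
  have hinv : (Φ.form - s • killingForm ℂ 𝔤).lieInvariant 𝔤 := fun x y z => by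
    have h1 := LieModule.traceForm_lieInvariant ℂ 𝔤 𝔤 x y z
    simp only [LinearMap.sub_apply, LinearMap.smul_apply, Φ.invariant x y z, h1, smul_eq_mul]
    ring
  have h0 := (IsSimple.eq_bot_or_eq_top (R := ℂ)
    (InvariantForm.orthogonal _ hinv (⊤ : LieIdeal ℂ 𝔤))).resolve_left fun h => hv.2 <| by
      have : v ∈ InvariantForm.orthogonal _ hinv (⊤ : LieIdeal ℂ 𝔤) := by
        rw [InvariantForm.mem_orthogonal]
        intro x _
        rw [LinearMap.sub_apply, LinearMap.sub_apply, ← Φ.symm.eq v x, ← hT,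
          hv.apply_eq_smul]
        simp [LieModule.traceForm_comm ℂ 𝔤 𝔤 v x]
      rwa [h, LieSubmodule.mem_bot] at this
  have h1 : ∀ x y, Φ.form x y = s * killingForm ℂ 𝔤 x y := fun x y => by
    have : y ∈ InvariantForm.orthogonal _ hinv (⊤ : LieIdeal ℂ 𝔤) := by
      rw [h0]; exact LieSubmodule.mem_top y
    rw [InvariantForm.mem_orthogonal] at this
    simpa [sub_eq_zero] using this x trivial
  refine ⟨s, fun hs0 => hv.2 ?_, h1⟩
  exact Φ.nondegenerate.1 v fun y => by rw [h1, hs0, zero_mul]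

variable {H : LieSubalgebra ℂ 𝔤} [H.IsCartanSubalgebra]

variable (H) in
theorem nonempty_root : Nonempty H.root := by
  by_contra hne
  rw [not_nonempty_iff] at hne
  -- Without roots `H` would be zero, as the coroots span it; but the normalizer of zero is all of
  -- `𝔤`.
  have h0 : ∀ h ∈ H, h = 0 := fun h hh => by
    have : (⟨h, hh⟩ : H) ∈ Submodule.span ℂ (Set.range (rootSystem H).coroot) := by
      rw [RootPairing.IsRootSystem.span_coroot_eq_top]; trivial
    rw [Set.range_eq_empty, Submodule.span_empty, Submodule.mem_bot] at this
    exact congrArg Subtype.val this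
  have := nontrivial_of_isSimple (𝔤 := 𝔤)
  obtain ⟨y, hy⟩ := exists_ne (0 : 𝔤)
  refine hy (h0 y ?_)
  rw [← LieSubalgebra.IsCartanSubalgebra.self_normalizing (H := H), LieSubalgebra.mem_normalizer_iff]
  intro x hx
  rw [h0 x hx, lie_zero]
  exact H.zero_mem

/-- The value is the sum of `β (α^∨)²` over the roots `β`, and the term `β = α` is `4`. -/
theorem killingForm_coroot_natural (α : H.root) :
    ∃ N : ℕ, 0 < N ∧ killingForm ℂ 𝔤 (coroot α.1) (coroot α.1) = N := by
  choose p hp using fun β : H.root => root_apply_coroot_int β α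
  refine ⟨∑ β, (p β).natAbs ^ 2, ?_, ?_⟩
  · refine Finset.sum_pos' (fun _ _ => Nat.zero_le _) ⟨α, Finset.mem_univ _, ?_⟩
    have : p α ≠ 0 := fun h => by
      have := hp α
      rw [root_apply_coroot (H.isNonZero_coe_root α), h] at this
      norm_num at this
    positivity
  · have h1 : killingForm ℂ 𝔤 (coroot α.1) (coroot α.1) =
        (rootSystem H).CorootForm (coroot α.1) (coroot α.1) := by
      rw [corootForm_rootSystem_eq_killing]; rfl
    rw [h1, RootPairing.corootForm_apply_apply]
    push_cast
    refine Finset.sum_congr rfl fun β _ => ?_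
    change β.1 (coroot α.1) * β.1 (coroot α.1) = _
    have : ((p β).natAbs ^ 2 : ℤ) = p β * p β := by rw [pow_two, Int.natAbs_mul_self']
    rw [hp, ← Int.cast_mul, ← this, Int.cast_pow, Int.cast_natCast]

/-- With `Φ.form = s κ` and `N α = κ(α^∨, α^∨) > 0`, one has `2 q α = level * s * N α`, so the `q α`
are positive multiples of one nonzero number. -/
theorem AffRep.exists_level_signs {Φ : InvForm 𝔤} {V : Type*} [AddCommGroup V] [Module ℂ V]
    (ρ : AffRep Φ H V) (hlevel : ρ.level ≠ 0) (hne : ∃ l n, ρ.W l n ≠ ⊥) :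
    ∃ q : H.root → ℤ,
      (∀ α, ρ.level * (Φ.form (coroot α.1) (coroot α.1) / 2) = q α) ∧
      ((∀ α, 0 < q α) ∨ ∀ α, q α < 0) := by
  obtain ⟨l, n, h⟩ := hne
  choose q hq using ρ.exists_int_level h
  obtain ⟨s, hs, hΦ⟩ := Φ.exists_eq_smul_killingForm
  choose N hN0 hN using killingForm_coroot_natural (H := H)
  have h1 : ∀ α, ρ.level * s * N α = 2 * q α := fun α => by
    rw [← hq, hΦ, hN]; ring
  have h2 : ∀ α β, q α * N β = q β * N α := fun α β => by
    have a := h1 α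
    have b := h1 β
    have : (q α * N β : ℂ) = q β * N α := by
      linear_combination (N α / 2 : ℂ) * b - (N β / 2 : ℂ) * a
    exact_mod_cast this
  have h3 : ∀ α, q α ≠ 0 := fun α h0 => by
    have a := h1 α
    rw [h0, Int.cast_zero, mul_zero] at a
    exact mul_ne_zero (mul_ne_zero hlevel hs) (by exact_mod_cast (hN0 α).ne') a
  obtain ⟨β⟩ := nonempty_root H
  refine ⟨q, hq, (h3 β).lt_or_gt.symm.imp (fun hβ α => ?_) fun hβ α => ?_⟩
  · have a := h2 α β
    have b : (0 : ℤ) < N α := by exact_mod_cast hN0 α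
    have c : (0 : ℤ) < N β := by exact_mod_cast hN0 β
    exact pos_of_mul_pos_left (a ▸ mul_pos hβ b) c.le
  · have a := h2 α β
    have b : (0 : ℤ) < N α := by exact_mod_cast hN0 α
    have c : (0 : ℤ) < N β := by exact_mod_cast hN0 β
    by_contra hcon
    have := mul_neg_of_neg_of_pos hβ b
    have := mul_nonneg (not_lt.mp hcon) c.le
    omega

end Simple

/-! ### Weights of `𝔏(A)` -/

section Weights

variable {Φ : InvForm 𝔤} {H : LieSubalgebra ℂ 𝔤}

/-- The functional `(h, k, r, c) ↦ l h + k c₁ + r r₁ + c c₂` on `𝔥 ⊕ ℂ K ⊕ ℂ d 0 ⊕ ℂ C`. -/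
def mkWeight (l : Module.Dual ℂ H) (c₁ r₁ c₂ : ℂ) : Module.Dual ℂ (Cartan H) :=
  l.coprod ((LinearMap.toSpanSingleton ℂ ℂ c₁).coprod
    ((LinearMap.toSpanSingleton ℂ ℂ r₁).coprod (LinearMap.toSpanSingleton ℂ ℂ c₂)))

theorem mkWeight_apply (l : Module.Dual ℂ H) (c₁ r₁ c₂ : ℂ) (h : H) (k r c : ℂ) :
    mkWeight l c₁ r₁ c₂ (h, k, r, c) = l h + (k * c₁ + (r * r₁ + c * c₂)) := rfl

theorem mkWeight_add (l l' : Module.Dual ℂ H) (c₁ r₁ c₂ c₁' r₁' c₂' : ℂ) :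
    mkWeight l c₁ r₁ c₂ + mkWeight l' c₁' r₁' c₂' =
      mkWeight (l + l') (c₁ + c₁') (r₁ + r₁') (c₂ + c₂') := by
  refine LinearMap.ext fun ⟨h, k, r, c⟩ => ?_
  rw [LinearMap.add_apply, mkWeight_apply, mkWeight_apply, mkWeight_apply, LinearMap.add_apply]
  ring

theorem exists_eq_mkWeight (μ : Module.Dual ℂ (Cartan H)) :
    ∃ l c₁ r₁ c₂, μ = mkWeight l c₁ r₁ c₂ := by
  refine ⟨μ.comp (LinearMap.inl ℂ _ _), μ (0, 1, 0, 0), μ (0, 0, 1, 0), μ (0, 0, 0, 1),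
    LinearMap.ext fun ⟨h, k, r, c⟩ => ?_⟩
  rw [mkWeight_apply, ← smul_eq_mul, ← smul_eq_mul, ← smul_eq_mul, ← map_smul, ← map_smul,
    ← map_smul, LinearMap.comp_apply, LinearMap.inl_apply, ← map_add, ← map_add, ← map_add]
  simp

variable (Φ H) in
/-- The elements of `𝔏` of weight `η`. -/
def adWeightSpace (η : Module.Dual ℂ (Cartan H)) : Submodule ℂ (AffVir Φ) where
  carrier := {X | ∀ h : Cartan H, ⁅cartanIncl Φ H h, X⁆ = η h • X}
  add_mem' hX hY h := by rw [lie_add, hX h, hY h, smul_add]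
  zero_mem' h := by rw [lie_zero, smul_zero]
  smul_mem' t X hX h := by rw [lie_smul, hX h, smul_comm]

theorem K_mem_adWeightSpace : AffVir.K Φ ∈ adWeightSpace Φ H 0 := fun h => by
  rw [← lie_skew, AffVir.lie_K, neg_zero, LinearMap.zero_apply, zero_smul]

theorem C_mem_adWeightSpace : AffVir.C Φ ∈ adWeightSpace Φ H 0 := fun h => by
  rw [← lie_skew, AffVir.lie_C, neg_zero, LinearMap.zero_apply, zero_smul]

theorem d_mem_adWeightSpace (n : ℤ) : AffVir.d Φ n ∈ adWeightSpace Φ H (mkWeight 0 0 n 0) := by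
  rintro ⟨h, k, r, c⟩
  rw [cartanIncl_apply, mkWeight_apply, add_lie, add_lie, add_lie, smul_lie, smul_lie, smul_lie,
    AffVir.lie_K, AffVir.lie_C, AffVir.lie_d_d, ← lie_skew, AffVir.lie_d_x]
  simp [smul_smul]

theorem x_mem_adWeightSpace_of_lie (n : ℤ) (y : 𝔤) (χ : Module.Dual ℂ H)
    (hy : ∀ h : H, ⁅(h : 𝔤), y⁆ = χ h • y) :
    AffVir.x Φ n y ∈ adWeightSpace Φ H (mkWeight χ 0 n 0) := by
  rintro ⟨h, k, r, c⟩
  rw [cartanIncl_apply, mkWeight_apply, add_lie, add_lie, add_lie, smul_lie, smul_lie, smul_lie,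
    AffVir.lie_K, AffVir.lie_C, AffVir.lie_d_x, AffVir.lie_x_x, hy, map_smul]
  simp only [Int.cast_zero, zero_mul, ite_self, zero_smul, add_zero, zero_add, smul_zero, mul_zero,
    smul_smul, ← add_smul]

variable {A : Type*} [CommRing A] [Algebra ℂ A]
  {V : Type*} [AddCommGroup V] [Module ℂ V] [LieRingModule (LA A Φ) V] [LieModule ℂ (LA A Φ) V]

theorem lie_mem_weightSpace {η μ : Module.Dual ℂ (Cartan H)} {X : AffVir Φ}
    (hX : X ∈ adWeightSpace Φ H η) (a : A) {v : V} (hv : v ∈ weightSpace A Φ H V μ) :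
    ⁅(LA.tmul X a : LA A Φ), v⁆ ∈ weightSpace A Φ H V (μ + η) := fun h => by
  rw [leibniz_lie, LA.lie_tmul, hX h, one_mul, map_smul, LinearMap.smul_apply, smul_lie, hv h,
    lie_smul, ← add_smul, LinearMap.add_apply, add_comm]

variable [FiniteDimensional ℂ 𝔤] [H.IsCartanSubalgebra]

variable (H) in
theorem root_induction {p : 𝔤 → Prop} (h0 : p 0) (hadd : ∀ y z, p y → p z → p (y + z))
    (hs : ∀ χ : LieModule.Weight ℂ H 𝔤, ∀ y ∈ rootSpace H χ, p y) (y : 𝔤) : p y := by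
  have hy : y ∈ ⨆ χ : LieModule.Weight ℂ H 𝔤, rootSpace H χ := by
    rw [LieModule.iSup_genWeightSpace_eq_top' ℂ H 𝔤]; trivial
  exact LieSubmodule.iSup_induction _ (motive := p) hy hs h0 hadd

theorem weight_eq_zero_or_root (χ : LieModule.Weight ℂ H 𝔤) :
    χ.IsZero ∨ ∃ α : H.root, α.1 = χ := by
  by_cases h : χ.IsZero
  · exact Or.inl h
  · exact Or.inr ⟨⟨χ, by simpa using h⟩, rfl⟩

variable [LieAlgebra.IsKilling ℂ 𝔤]

theorem x_mem_adWeightSpace (n : ℤ) (y : 𝔤) (χ : Module.Dual ℂ H) (hy : y ∈ rootSpace H χ) :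
    AffVir.x Φ n y ∈ adWeightSpace Φ H (mkWeight χ 0 n 0) :=
  x_mem_adWeightSpace_of_lie n y χ fun h => IsKilling.lie_eq_smul_of_mem_rootSpace hy h

theorem lie_cartanIncl (h h' : Cartan H) : ⁅cartanIncl Φ H h, cartanIncl Φ H h'⁆ = 0 := by
  obtain ⟨h', k, r, c⟩ := h'
  have h1 := x_mem_adWeightSpace (Φ := Φ) 0 h' 0 (mem_rootSpace_zero h') h
  have h2 := d_mem_adWeightSpace (Φ := Φ) 0 h
  rw [cartanIncl_apply Φ H h' k r c, lie_add, lie_add, lie_add, lie_smul, lie_smul, lie_smul,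
    K_mem_adWeightSpace h, C_mem_adWeightSpace h, h1, h2]
  obtain ⟨h, k', r', c'⟩ := h
  simp [mkWeight_apply]

/-- An element of `𝔥` on which each root takes its height as value. -/
theorem exists_height_element (b : (IsKilling.rootSystem H).Base) :
    ∃ r : H, ∀ α : H.root, α.1 r = (b.height α : ℂ) := by
  let f : Module.Dual ℂ (Module.Dual ℂ H) := b.toWeightBasis.constr ℂ fun _ => (1 : ℂ)
  refine ⟨(Module.evalEquiv ℂ H).symm f, fun α => ?_⟩
  obtain ⟨g, -, -, hg⟩ := b.exists_root_eq_sum_int α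
  have h1 : α.1 ((Module.evalEquiv ℂ H).symm f) = f ((IsKilling.rootSystem H).root α) :=
    Module.apply_evalEquiv_symm_apply ℂ H ((IsKilling.rootSystem H).root α) f
  rw [h1, b.height_eq_sum hg, hg, map_sum, Int.cast_sum]
  refine Finset.sum_congr rfl fun i hi => ?_
  have h2 : f ((IsKilling.rootSystem H).root i) = 1 := by
    have := b.toWeightBasis.constr_basis ℂ (fun _ => (1 : ℂ)) ⟨i, hi⟩
    rwa [b.toWeightBasis_apply] at this
  rw [map_zsmul, h2, zsmul_one]

theorem height_negRoot (b : (IsKilling.rootSystem H).Base) (α : H.root) :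
    b.height (AffRep.negRoot α) = -b.height α := by
  obtain ⟨r, hr⟩ := exists_height_element b
  have h1 := hr (AffRep.negRoot α)
  have h2 : (AffRep.negRoot α).1 r = -α.1 r := rfl
  rw [h2, hr] at h1
  exact_mod_cast h1.symm

/-- The triangular decomposition of `𝔏`. -/
theorem posPart_sup_negPart (b : (IsKilling.rootSystem H).Base) :
    posPart Φ b ⊔ negPart Φ b ⊔ LinearMap.range (cartanIncl Φ H) = ⊤ := by
  have hP : posPart Φ b ≤ posPart Φ b ⊔ negPart Φ b ⊔ LinearMap.range (cartanIncl Φ H) :=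
    le_sup_left.trans le_sup_left
  have hN : negPart Φ b ≤ posPart Φ b ⊔ negPart Φ b ⊔ LinearMap.range (cartanIncl Φ H) :=
    le_sup_right.trans le_sup_left
  have hC : LinearMap.range (cartanIncl Φ H) ≤
      posPart Φ b ⊔ negPart Φ b ⊔ LinearMap.range (cartanIncl Φ H) := le_sup_right
  generalize posPart Φ b ⊔ negPart Φ b ⊔ LinearMap.range (cartanIncl Φ H) = S at hP hN hC
  rw [eq_top_iff, ← AffVir.span_eq_top, Submodule.span_le]
  rintro _ ((⟨n, y, rfl⟩ | ⟨n, rfl⟩) | rfl | rfl)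
  · rcases lt_trichotomy n 0 with hn | rfl | hn
    · exact hN (Submodule.subset_span (Or.inl (Or.inr ⟨n, hn, y, rfl⟩)))
    · induction y using root_induction (H := H) with
      | h0 => rw [map_zero]; exact S.zero_mem
      | hadd y z hy hz => rw [map_add]; exact S.add_mem hy hz
      | hs χ y hy =>
        obtain h | ⟨α, rfl⟩ := weight_eq_zero_or_root χ
        · rw [h, rootSpace_zero_eq] at hy
          exact hC ⟨(⟨y, hy⟩, 0, 0, 0), by simp [cartanIncl_apply]⟩
        · by_cases hα : b.IsPos α
          · exact hP (Submodule.subset_span (Or.inl (Or.inl ⟨α, hα, y, hy, rfl⟩)))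
          · refine hN (Submodule.subset_span (Or.inl (Or.inl ⟨AffRep.negRoot α, ?_, y, ?_, rfl⟩)))
            · rw [RootPairing.Base.isPos_iff] at hα
              have := b.height_ne_zero α
              rw [RootPairing.Base.isPos_iff, height_negRoot]
              omega
            · simpa [AffRep.negRoot] using hy
    · exact hP (Submodule.subset_span (Or.inl (Or.inr ⟨n, hn, y, rfl⟩)))
  · rcases lt_trichotomy n 0 with hn | rfl | hn
    · exact hN (Submodule.subset_span (Or.inr ⟨n, hn, rfl⟩))
    · exact hC ⟨(0, 0, 1, 0), by simp [cartanIncl_apply]⟩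
    · exact hP (Submodule.subset_span (Or.inr ⟨n, hn, rfl⟩))
  · exact hC ⟨(0, 1, 0, 0), by simp [cartanIncl_apply]⟩
  · exact hC ⟨(0, 0, 0, 1), by simp [cartanIncl_apply]⟩

/-- An element `D` of the Cartan subalgebra whose eigenvalues on `posPart` are positive integers and
on `negPart` negative integers. -/
theorem exists_grading_element (b : (IsKilling.rootSystem H).Base) :
    ∃ D : Cartan H,
      posPart Φ b ≤ Submodule.span ℂ
        {X | ∃ j : ℕ, ⁅cartanIncl Φ H D, X⁆ = (-(-1 : ℂ) * (j + 1 : ℕ)) • X} ∧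
      negPart Φ b ≤ Submodule.span ℂ
        {X | ∃ j : ℕ, ⁅cartanIncl Φ H D, X⁆ = (-(1 : ℂ) * (j + 1 : ℕ)) • X} := by
  obtain ⟨r, hr⟩ := exists_height_element b
  -- The element is `D = r + B d 0`, with eigenvalue `χ(r) + B n` on `y ⊗ tⁿ` for `y` of weight `χ`.
  -- As `B` exceeds all `|χ(r)|`, the sign is that of `n` when `n ≠ 0` and that of the height when
  -- `n = 0`.
  obtain ⟨B, hB⟩ : ∃ B : ℤ, 0 < B ∧ ∀ α, |b.height α| < B := by
    obtain ⟨B, hB⟩ := (Set.finite_range fun α => |b.height α|).bddAbove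
    exact ⟨max B 0 + 1, by omega, fun α => by have := hB ⟨α, rfl⟩; simp only at this; omega⟩
  have hx : ∀ (n : ℤ) (χ : LieModule.Weight ℂ H 𝔤), ∀ y ∈ rootSpace H χ, ∀ z : ℤ,
      χ r + B * n = z → ⁅cartanIncl Φ H (r, 0, (B : ℂ), 0), AffVir.x Φ n y⁆ =
        (z : ℂ) • AffVir.x Φ n y := fun n χ y hy z hz => by
    rw [x_mem_adWeightSpace n y χ.toLinear hy, mkWeight_apply, ← hz]
    simp
  have hd : ∀ (n : ℤ), ⁅cartanIncl Φ H (r, 0, (B : ℂ), 0), AffVir.d Φ n⁆ =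
        ((B * n : ℤ) : ℂ) • AffVir.d Φ n := fun n => by
    rw [d_mem_adWeightSpace n, mkWeight_apply]
    simp
  have hw : ∀ χ : LieModule.Weight ℂ H 𝔤, ∃ m : ℤ, χ r = m ∧ |m| < B := fun χ => by
    obtain h | ⟨α, rfl⟩ := weight_eq_zero_or_root χ
    · exact ⟨0, by simp [h.eq], by simpa using hB.1⟩
    · exact ⟨_, hr α, hB.2 α⟩
  have pos : ∀ (X : AffVir Φ) (z : ℤ), 0 < z →
      ⁅cartanIncl Φ H (r, 0, (B : ℂ), 0), X⁆ = (z : ℂ) • X → ∃ j : ℕ,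
        ⁅cartanIncl Φ H (r, 0, (B : ℂ), 0), X⁆ = (-(-1 : ℂ) * (j + 1 : ℕ)) • X := fun X z hz h => by
    lift z to ℕ using hz.le
    refine ⟨z - 1, ?_⟩
    rw [h, Nat.sub_add_cancel (by omega)]
    simp
  have neg : ∀ (X : AffVir Φ) (z : ℤ), z < 0 →
      ⁅cartanIncl Φ H (r, 0, (B : ℂ), 0), X⁆ = (z : ℂ) • X → ∃ j : ℕ,
        ⁅cartanIncl Φ H (r, 0, (B : ℂ), 0), X⁆ = (-(1 : ℂ) * (j + 1 : ℕ)) • X := fun X z hz h => by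
    obtain ⟨m, rfl⟩ : ∃ m : ℕ, z = -m := ⟨z.natAbs, by omega⟩
    refine ⟨m - 1, ?_⟩
    rw [h, Nat.sub_add_cancel (by omega)]
    simp
  refine ⟨(r, 0, (B : ℂ), 0), Submodule.span_le.mpr ?_, Submodule.span_le.mpr ?_⟩
  · rintro _ ((⟨α, hα, y, hy, rfl⟩ | ⟨n, hn, y, rfl⟩) | ⟨n, hn, rfl⟩)
    · exact Submodule.subset_span (pos _ _ hα (hx 0 α.1 y hy _ (by simp [hr])))
    · induction y using root_induction (H := H) with
      | h0 => rw [map_zero]; exact Submodule.zero_mem _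
      | hadd y z hy hz => rw [map_add]; exact Submodule.add_mem _ hy hz
      | hs χ y hy =>
        obtain ⟨m, hm, hmB⟩ := hw χ
        refine Submodule.subset_span (pos _ (m + B * n) ?_ (hx n χ y hy _ (by rw [hm]; simp)))
        have := neg_abs_le m
        nlinarith
    · exact Submodule.subset_span (pos _ _ (mul_pos hB.1 hn) (hd n))
  · rintro _ ((⟨α, hα, y, hy, rfl⟩ | ⟨n, hn, y, rfl⟩) | ⟨n, hn, rfl⟩)
    · refine Submodule.subset_span (neg _ (-b.height α) (by
        rw [RootPairing.Base.isPos_iff] at hα; omega) (hx 0 (-α.1) y (by simpa using hy) _ ?_))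
      simp [hr]
    · induction y using root_induction (H := H) with
      | h0 => rw [map_zero]; exact Submodule.zero_mem _
      | hadd y z hy hz => rw [map_add]; exact Submodule.add_mem _ hy hz
      | hs χ y hy =>
        obtain ⟨m, hm, hmB⟩ := hw χ
        refine Submodule.subset_span (neg _ (m + B * n) ?_ (hx n χ y hy _ (by rw [hm]; simp)))
        have := le_abs_self m
        nlinarith
    · exact Submodule.subset_span (neg _ _ (mul_neg_of_pos_of_neg hB.1 hn) (hd n))

end Weights

/-! ### Irreducible modules with an extremal weight -/

section Extremal

variable {Φ : InvForm 𝔤} {H : LieSubalgebra ℂ 𝔤} {A : Type*} [CommRing A] [Algebra ℂ A]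
  {V : Type*} [AddCommGroup V] [Module ℂ V] [LieRingModule (LA A Φ) V] [LieModule ℂ (LA A Φ) V]

theorem tmul_mem_loopOf {P : Submodule ℂ (AffVir Φ)} {X : AffVir Φ} (hX : X ∈ P) (a : A) :
    LA.tmul X a ∈ loopOf A P := Submodule.subset_span ⟨X, hX, a, rfl⟩

theorem forall_mem_loopOf_lie_mem {P : Submodule ℂ (AffVir Φ)} {E F : Submodule ℂ V}
    (h : ∀ X ∈ P, ∀ a : A, ∀ v ∈ E, ⁅(LA.tmul X a : LA A Φ), v⁆ ∈ F) :
    ∀ z ∈ loopOf A P, ∀ v ∈ E, ⁅z, v⁆ ∈ F := fun z hz v hv => by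
  induction hz using Submodule.span_induction with
  | mem z hz => obtain ⟨X, hX, a, rfl⟩ := hz; exact h X hX a v hv
  | zero => rw [zero_lie]; exact F.zero_mem
  | add y z _ _ hy hz => rw [add_lie]; exact F.add_mem hy hz
  | smul t z _ hz => rw [smul_lie]; exact F.smul_mem t hz

theorem mem_loopOf_sup {P N : Submodule ℂ (AffVir Φ)} (h : P ⊔ N = ⊤) (z : LA A Φ) :
    z ∈ loopOf A P ⊔ loopOf A N := by
  have hz : z ∈ Submodule.span ℂ {z : LA A Φ | ∃ X a, z = LA.tmul X a} := by
    rw [LA.span_tmul]; trivial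
  refine Submodule.span_le.mpr ?_ hz
  rintro _ ⟨X, a, rfl⟩
  have hX : X ∈ P ⊔ N := h ▸ trivial
  obtain ⟨Y, hY, Z, hZ, rfl⟩ := Submodule.mem_sup.mp hX
  rw [map_add, LinearMap.add_apply]
  exact add_mem (Submodule.mem_sup_left (tmul_mem_loopOf hY a))
    (Submodule.mem_sup_right (tmul_mem_loopOf hZ a))

/-- A nonzero vector of an irreducible module is cyclic. -/
theorem exists_uea_apply_eq [LieModule.IsIrreducible ℂ (LA A Φ) V] {v : V} (hv : v ≠ 0) (w : V) :
    ∃ u : UniversalEnvelopingAlgebra ℂ (LA A Φ),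
      UniversalEnvelopingAlgebra.lift ℂ (LieModule.toEnd ℂ (LA A Φ) V) u v = w := by
  let f := UniversalEnvelopingAlgebra.lift ℂ (LieModule.toEnd ℂ (LA A Φ) V)
  let N : LieSubmodule ℂ (LA A Φ) V :=
    { LinearMap.range ((LinearMap.applyₗ v).comp f.toLinearMap) with
      lie_mem := by
        rintro x _ ⟨u, rfl⟩
        refine ⟨UniversalEnvelopingAlgebra.ι ℂ x * u, ?_⟩
        change f (_ * u) v = ⁅x, f u v⁆
        rw [map_mul, Module.End.mul_apply]
        exact LinearMap.congr_fun (UniversalEnvelopingAlgebra.lift_ι_apply ℂ _ x) _ }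
  have hvN : v ∈ N := ⟨1, by change f 1 v = v; rw [map_one]; rfl⟩
  have hN : N = ⊤ := (eq_bot_or_eq_top N).resolve_left fun h => hv (by
    rwa [h, LieSubmodule.mem_bot] at hvN)
  have hw : w ∈ N := hN ▸ LieSubmodule.mem_top w
  exact hw

/-- If `𝔏(A) = N + Q` and `E` is a nonzero `Q`-stable subspace of an irreducible module, the module
is the only `N`-stable subspace containing `E`. -/
theorem le_of_triangular [LieModule.IsIrreducible ℂ (LA A Φ) V] {Q N : Submodule ℂ (LA A Φ)}
    (hQN : ∀ z, z ∈ N ⊔ Q) {E F : Submodule ℂ V} (hE : E ≠ ⊥)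
    (hQ : ∀ z ∈ Q, ∀ v ∈ E, ⁅z, v⁆ ∈ E) (hEF : E ≤ F) (hN : ∀ z ∈ N, ∀ v ∈ F, ⁅z, v⁆ ∈ F) :
    F = ⊤ := by
  -- `W` plays the role of `U(N) E`, without a PBW theorem or the assumption that `N` and `Q` are
  -- subalgebras.
  set W : Submodule ℂ V :=
    sInf {F | E ≤ F ∧ ∀ z ∈ N, ∀ v ∈ F, ⁅z, v⁆ ∈ F} with hW
  have hEW : E ≤ W := le_sInf fun F hF => hF.1
  have hNW : ∀ z ∈ N, ∀ v ∈ W, ⁅z, v⁆ ∈ W := fun z hz v hv => by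
    rw [hW, Submodule.mem_sInf] at hv ⊢
    exact fun F hF => hF.2 z hz v (hv F hF)
  let S : Submodule ℂ V :=
    { carrier := {w | w ∈ W ∧ ∀ z ∈ Q, ⁅z, w⁆ ∈ W}
      add_mem' := fun hv hw => ⟨W.add_mem hv.1 hw.1, fun z hz => by
        rw [lie_add]; exact W.add_mem (hv.2 z hz) (hw.2 z hz)⟩
      zero_mem' := ⟨W.zero_mem, fun z _ => by rw [lie_zero]; exact W.zero_mem⟩
      smul_mem' := fun t v hv => ⟨W.smul_mem t hv.1, fun z hz => by
        rw [lie_smul]; exact W.smul_mem t (hv.2 z hz)⟩ }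
  have hall : ∀ w ∈ S, ∀ z : LA A Φ, ⁅z, w⁆ ∈ W := fun w hw z => by
    obtain ⟨y, hy, x, hx, rfl⟩ := Submodule.mem_sup.mp (hQN z)
    rw [add_lie]
    exact W.add_mem (hNW y hy w hw.1) (hw.2 x hx)
  -- For `z ∈ N`, `x ∈ Q` and `w ∈ S`, `x z w = [x, z] w + z x w`, and `[x, z]` lies in `N + Q`. So
  -- `S` is `N`-stable and contains `E`; by minimality it contains `W`, which is therefore a
  -- submodule.
  have hWS : W ≤ S := sInf_le ⟨fun w hw => ⟨hEW hw, fun z hz => hEW (hQ z hz w hw)⟩,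
    fun z hz w hw => ⟨hNW z hz w hw.1, fun x hx => by
      rw [leibniz_lie]
      exact W.add_mem (hall w hw _) (hNW z hz _ (hw.2 x hx))⟩⟩
  let M : LieSubmodule ℂ (LA A Φ) V := { W with lie_mem := fun {z w} hw => hall w (hWS hw) z }
  have hM : M = ⊤ := (eq_bot_or_eq_top M).resolve_left fun h => hE (by
    rw [eq_bot_iff]
    intro v hv
    have : v ∈ M := hEW hv
    rwa [h] at this)
  rw [eq_top_iff]
  intro v _
  have hv : v ∈ M := hM ▸ LieSubmodule.mem_top v
  exact (sInf_le ⟨hEF, hN⟩ : W ≤ F) hv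

variable [LieAlgebra.IsKilling ℂ 𝔤] [FiniteDimensional ℂ 𝔤] [H.IsCartanSubalgebra]

theorem lie_mem_weightSpace_of_mem_cartan {μ : Module.Dual ℂ (Cartan H)} (h : Cartan H) (a : A)
    {v : V} (hv : v ∈ weightSpace A Φ H V μ) :
    ⁅(LA.tmul (cartanIncl Φ H h) a : LA A Φ), v⁆ ∈ weightSpace A Φ H V μ := by
  have := lie_mem_weightSpace (η := 0) (X := cartanIncl Φ H h) (fun h' => by
    rw [lie_cartanIncl, LinearMap.zero_apply, zero_smul]) a hv
  rwa [add_zero] at this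

/-- If an irreducible module has a nonzero weight space annihilated by `P ⊗ A`, for a triangular
decomposition with positive part `P`, this weight space is one-dimensional and generates. -/
theorem isGeneratedByExtremal_of_lie_eq_zero [LieModule.IsIrreducible ℂ (LA A Φ) V]
    (hV : IsIntegrable A Φ H V) {P N : Submodule ℂ (AffVir Φ)}
    (hPN : P ⊔ N ⊔ LinearMap.range (cartanIncl Φ H) = ⊤) {s : ℂ} (hs : s ≠ 0) (D : Cartan H)
    (hN : N ≤ Submodule.span ℂ
      {X | ∃ j : ℕ, ⁅cartanIncl Φ H D, X⁆ = (-s * (j + 1 : ℕ)) • X})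
    (μ : Module.Dual ℂ (Cartan H)) (hμ : weightSpace A Φ H V μ ≠ ⊥)
    (hP : ∀ X ∈ P, ∀ a : A, ∀ v ∈ weightSpace A Φ H V μ, ⁅(LA.tmul X a : LA A Φ), v⁆ = 0) :
    IsGeneratedByExtremal A Φ V H (loopOf A P) μ ∧
      Module.finrank ℂ (weightSpace A Φ H V μ) = 1 := by
  have hfd := hV.finiteDimensional μ
  have hP' : ∀ z ∈ loopOf A P, ∀ v ∈ weightSpace A Φ H V μ, ⁅z, v⁆ = 0 := fun z hz v hv => by
    simpa using forall_mem_loopOf_lie_mem (F := (⊥ : Submodule ℂ V))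
      (fun X hX a v hv => (Submodule.mem_bot ℂ).mpr (hP X hX a v hv)) z hz v hv
  -- stable subspaces of the weight space
  have key : ∀ E ≤ weightSpace A Φ H V μ, E ≠ ⊥ →
      (∀ h a, ∀ v ∈ E, ⁅(LA.tmul (cartanIncl Φ H h) a : LA A Φ), v⁆ ∈ E) →
      weightSpace A Φ H V μ ≤ E := by
    intro E hE hE0 hstab
    set T : Module.End ℂ V := LieModule.toEnd ℂ (LA A Φ) V (LA.tmul (cartanIncl Φ H D) 1) with hT
    set r : ℂ := μ D
    -- `S` collects the `D`-eigenvalues strictly beyond `r`, in the direction fixed by `s`, so it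
    -- meets the weight space trivially.
    set S : Submodule ℂ V := ⨆ j : ℕ, T.eigenspace (r - s * (j + 1 : ℕ)) with hS
    have hμT : weightSpace A Φ H V μ ≤ T.eigenspace r := fun v hv =>
      Module.End.mem_eigenspace_iff.mpr (hv D)
    have hdisj : weightSpace A Φ H V μ ⊓ S = ⊥ := by
      rw [← disjoint_iff]
      refine (T.eigenspaces_iSupIndep r).mono hμT (iSup_le fun j => ?_)
      refine le_iSup₂_of_le (r - s * (j + 1 : ℕ)) ?_ le_rfl
      rw [Ne, sub_eq_self, mul_eq_zero, not_or]
      exact ⟨hs, by exact_mod_cast Nat.succ_ne_zero j⟩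
    -- Here the eigenvalue is `r - s * j`: the case `j = 0` covers `E`, and `j + 1` covers the
    -- summands of `S`.
    have hNS : ∀ X ∈ N, ∀ a : A, ∀ j : ℕ, ∀ v ∈ T.eigenspace (r - s * j),
        ⁅(LA.tmul X a : LA A Φ), v⁆ ∈ S := fun X hX a j v hv => by
      replace hX := hN hX
      induction hX using Submodule.span_induction with
      | mem X hX =>
        obtain ⟨i, hi⟩ := hX
        refine Submodule.mem_iSup_of_mem (j + i) (Module.End.mem_eigenspace_iff.mpr ?_)
        have hv' : ⁅(LA.tmul (cartanIncl Φ H D) 1 : LA A Φ), v⁆ = (r - s * j) • v :=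
          Module.End.mem_eigenspace_iff.mp hv
        rw [hT, LieModule.toEnd_apply_apply, leibniz_lie, LA.lie_tmul, hi, one_mul, map_smul,
          LinearMap.smul_apply, smul_lie, hv', lie_smul, ← add_smul]
        congr 1
        push_cast
        ring
      | zero => rw [map_zero, LinearMap.zero_apply, zero_lie]; exact S.zero_mem
      | add y z _ _ hy hz => rw [map_add, LinearMap.add_apply, add_lie]; exact S.add_mem hy hz
      | smul t z _ hz => rw [map_smul, LinearMap.smul_apply, smul_lie]; exact S.smul_mem t hz
    have hNE : ∀ X ∈ N, ∀ a : A, ∀ v ∈ E ⊔ S, ⁅(LA.tmul X a : LA A Φ), v⁆ ∈ E ⊔ S := by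
      intro X hX a v hv
      have h1 : E ⊔ S ≤ S.comap (LieModule.toEnd ℂ (LA A Φ) V (LA.tmul X a)) := by
        refine sup_le (fun v hv => hNS X hX a 0 v ?_) (iSup_le fun j v hv => hNS X hX a _ v hv)
        simpa using hμT (hE hv)
      exact Submodule.mem_sup_right (h1 hv)
    have htop : E ⊔ S = ⊤ := by
      refine le_of_triangular (Q := loopOf A (P ⊔ LinearMap.range (cartanIncl Φ H)))
        (N := loopOf A N) (fun z => mem_loopOf_sup ?_ z) hE0 ?_ le_sup_left
        (forall_mem_loopOf_lie_mem hNE)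
      · rw [← hPN, sup_comm P N, sup_assoc]
      · refine forall_mem_loopOf_lie_mem fun X hX a v hv => ?_
        obtain ⟨Y, hY, _, ⟨h, rfl⟩, rfl⟩ := Submodule.mem_sup.mp hX
        rw [map_add, LinearMap.add_apply, add_lie, hP Y hY a v (hE hv), zero_add]
        exact hstab h a v hv
    -- The modular law applies since `E` lies in the weight space; with `E ⊔ S = ⊤` and the trivial
    -- intersection it gives equality with `E`.
    have : weightSpace A Φ H V μ ⊓ (E ⊔ S) = E ⊔ weightSpace A Φ H V μ ⊓ S := by
      rw [inf_comm, sup_inf_assoc_of_le S hE, inf_comm]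
    rw [htop, hdisj, inf_top_eq, sup_bot_eq] at this
    exact this.le
  have hscalar : ∀ h a, ∃ t : ℂ, ∀ v ∈ weightSpace A Φ H V μ,
      ⁅(LA.tmul (cartanIncl Φ H h) a : LA A Φ), v⁆ = t • v := by
    intro h a
    set T : Module.End ℂ V := LieModule.toEnd ℂ (LA A Φ) V (LA.tmul (cartanIncl Φ H h) a) with hT
    have hm : ∀ v ∈ weightSpace A Φ H V μ, T v ∈ weightSpace A Φ H V μ := fun v hv =>
      lie_mem_weightSpace_of_mem_cartan h a hv
    have : Nontrivial (weightSpace A Φ H V μ) := Submodule.nontrivial_iff_ne_bot.mpr hμ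
    obtain ⟨t, ht⟩ := Module.End.exists_eigenvalue (T.restrict hm)
    obtain ⟨w, hw⟩ := ht.exists_hasEigenvector
    refine ⟨t, fun v hv => ?_⟩
    -- The Cartan part tensored with `A` is commutative, so an eigenspace of one element is stable
    -- under all. Hence every element acts by a scalar, and any line in the weight space is stable.
    have h1 := key (weightSpace A Φ H V μ ⊓ T.eigenspace t) inf_le_left (fun h0 => hw.2 ?_) ?_
    · exact Module.End.mem_eigenspace_iff.mp (h1 hv).2
    · have : (w : V) ∈ weightSpace A Φ H V μ ⊓ T.eigenspace t :=
        ⟨w.2, Module.End.mem_eigenspace_iff.mpr (congrArg Subtype.val hw.apply_eq_smul)⟩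
      rw [h0, Submodule.mem_bot] at this
      exact Subtype.ext this
    · intro h' a' v hv
      refine ⟨lie_mem_weightSpace_of_mem_cartan h' a' hv.1, Module.End.mem_eigenspace_iff.mpr ?_⟩
      have hv2 : ⁅(LA.tmul (cartanIncl Φ H h) a : LA A Φ), v⁆ = t • v :=
        Module.End.mem_eigenspace_iff.mp hv.2
      rw [hT, LieModule.toEnd_apply_apply, leibniz_lie, LA.lie_tmul, lie_cartanIncl, map_zero,
        LinearMap.zero_apply, zero_lie, zero_add, hv2, lie_smul]
  obtain ⟨v, hv, hv0⟩ := Submodule.exists_mem_ne_zero_of_ne_bot hμ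
  refine ⟨⟨hV.isWeightModule, v, hv, hv0, fun z hz => hP' z hz v hv,
    fun w => exists_uea_apply_eq hv0 w⟩, ?_⟩
  have hspan : weightSpace A Φ H V μ = ℂ ∙ v := by
    have hle : ℂ ∙ v ≤ weightSpace A Φ H V μ := by rwa [Submodule.span_singleton_le_iff_mem]
    refine le_antisymm (key _ hle (by rwa [Ne, Submodule.span_singleton_eq_bot]) ?_) hle
    intro h a w hw
    obtain ⟨t, ht⟩ := hscalar h a
    rw [ht w (hle hw)]
    exact Submodule.smul_mem _ t hw
  rw [hspan]
  exact finrank_span_singleton hv0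

end Extremal

/-! ### Integrable irreducible modules of nonzero level -/

section Integrable

variable {Φ : InvForm 𝔤} {H : LieSubalgebra ℂ 𝔤} {A : Type*} [CommRing A] [Algebra ℂ A]
  {V : Type*} [AddCommGroup V] [Module ℂ V] [LieRingModule (LA A Φ) V] [LieModule ℂ (LA A Φ) V]

theorem lie_tmul_K (z : LA A Φ) (a : A) : ⁅LA.tmul (AffVir.K Φ) a, z⁆ = 0 := by
  have hz : z ∈ Submodule.span ℂ {z : LA A Φ | ∃ X a, z = LA.tmul X a} := by
    rw [LA.span_tmul]; trivial
  induction hz using Submodule.span_induction with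
  | mem z hz =>
    obtain ⟨X, a', rfl⟩ := hz
    rw [LA.lie_tmul, AffVir.lie_K, map_zero, LinearMap.zero_apply]
  | zero => exact lie_zero _
  | add y z _ _ hy hz => rw [lie_add, hy, hz, add_zero]
  | smul t z _ hz => rw [lie_smul, hz, smul_zero]

/-- On an irreducible module, `K` acts by a scalar as soon as it has an eigenvector. -/
theorem lie_K_eq_smul [LieModule.IsIrreducible ℂ (LA A Φ) V] {c : ℂ} {v : V} (hv0 : v ≠ 0)
    (hv : ⁅(LA.tmul (AffVir.K Φ) 1 : LA A Φ), v⁆ = c • v) (w : V) :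
    ⁅(LA.tmul (AffVir.K Φ) 1 : LA A Φ), w⁆ = c • w := by
  let T : Module.End ℂ V := LieModule.toEnd ℂ (LA A Φ) V (LA.tmul (AffVir.K Φ) 1)
  let N : LieSubmodule ℂ (LA A Φ) V :=
    { T.eigenspace c with
      lie_mem := fun {z w} hw => by
        have hw' : ⁅(LA.tmul (AffVir.K Φ) 1 : LA A Φ), w⁆ = c • w :=
          Module.End.mem_eigenspace_iff.mp hw
        refine Module.End.mem_eigenspace_iff.mpr ?_
        change ⁅(LA.tmul (AffVir.K Φ) 1 : LA A Φ), _⁆ = _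
        rw [leibniz_lie, lie_tmul_K, zero_lie, zero_add, hw', lie_smul] }
  have hvN : v ∈ N := Module.End.mem_eigenspace_iff.mpr hv
  have hN : N = ⊤ := (eq_bot_or_eq_top N).resolve_left fun h => hv0 (by
    rwa [h, LieSubmodule.mem_bot] at hvN)
  have hw : w ∈ N := hN ▸ LieSubmodule.mem_top w
  exact Module.End.mem_eigenspace_iff.mp hw

theorem lie_d_mem_weightSpace (a : A) (l : Module.Dual ℂ H) (c r e : ℂ) (n k : ℤ) {v : V}
    (hv : v ∈ weightSpace A Φ H V (mkWeight l c (r + n) e)) :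
    ⁅(LA.tmul (AffVir.d Φ k) a : LA A Φ), v⁆ ∈
      weightSpace A Φ H V (mkWeight l c (r + (n + k : ℤ)) e) := by
  have := lie_mem_weightSpace (d_mem_adWeightSpace (Φ := Φ) (H := H) k) a hv
  rwa [mkWeight_add, add_zero, add_zero, add_zero, add_assoc, ← Int.cast_add] at this

variable [LieAlgebra.IsKilling ℂ 𝔤] [FiniteDimensional ℂ 𝔤] [H.IsCartanSubalgebra]

/-- The restriction to the affine algebra of an integrable module. -/
def IsIntegrable.affRep (hV : IsIntegrable A Φ H V) (c r e : ℂ)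
    (hc : ∀ v : V, ⁅(LA.tmul (AffVir.K Φ) 1 : LA A Φ), v⁆ = c • v) : AffRep Φ H V where
  X n := (LieModule.toEnd ℂ (LA A Φ) V : LA A Φ →ₗ[ℂ] Module.End ℂ V) ∘ₗ
    (LA.tmul.flip 1) ∘ₗ AffVir.x Φ n
  level := c
  -- The values `c` and `e` stay fixed because `K` and `C` are central, and `ad d 0` has integer
  -- eigenvalues, so one coset `r + ℤ` suffices.
  W l n := weightSpace A Φ H V (mkWeight l c (r + n) e)
  comm n m y z := by
    refine LinearMap.ext fun v => ?_
    change ⁅(LA.tmul (AffVir.x Φ n y) 1 : LA A Φ), ⁅(LA.tmul (AffVir.x Φ m z) 1 : LA A Φ), v⁆⁆ -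
      ⁅(LA.tmul (AffVir.x Φ m z) 1 : LA A Φ), ⁅(LA.tmul (AffVir.x Φ n y) 1 : LA A Φ), v⁆⁆ =
      ⁅(LA.tmul (AffVir.x Φ (n + m) ⁅y, z⁆) 1 : LA A Φ), v⁆ +
        ((if m = -n then (n : ℂ) * Φ.form y z else 0) * c) • v
    rw [leibniz_lie, add_sub_cancel_right, LA.lie_tmul, AffVir.lie_x_x, one_mul, map_add, map_smul,
      LinearMap.add_apply, LinearMap.smul_apply, add_lie, smul_lie, hc, smul_smul]
  weight l n v hv h := by
    have := hv (h, 0, 0, 0)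
    rw [cartanIncl_apply, mkWeight_apply] at this
    simpa using this
  maps l n k χ y hy v hv := by
    have := lie_mem_weightSpace (x_mem_adWeightSpace (Φ := Φ) k y χ hy) (1 : A) hv
    rwa [mkWeight_add, add_zero, add_zero, add_assoc, ← Int.cast_add] at this
  finiteDimensional l n := hV.finiteDimensional _
  nilpotent χ hχ k y hy v := hV.locallyNilpotent ⟨χ, by simpa using hχ⟩ k y hy 1 v

theorem lie_x_mem_weightSpace (a : A) (l : Module.Dual ℂ H) (c r e : ℂ) (n k : ℤ) {v : V}
    (hv : v ∈ weightSpace A Φ H V (mkWeight l c (r + n) e)) (χ : Module.Dual ℂ H) (y : 𝔤)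
    (hy : y ∈ rootSpace H χ) :
    ⁅(LA.tmul (AffVir.x Φ k y) a : LA A Φ), v⁆ ∈
      weightSpace A Φ H V (mkWeight (l + χ) c (r + (n + k : ℤ)) e) := by
  have := lie_mem_weightSpace (x_mem_adWeightSpace (Φ := Φ) k y χ hy) a hv
  rwa [mkWeight_add, add_zero, add_zero, add_assoc, ← Int.cast_add] at this

/-- All `(y ⊗ tᵏ) ⊗ a` vanish on a weight space if there are no weights in the target degree. -/
theorem lie_x_eq_zero_of_forall_eq_bot (a : A) (l : Module.Dual ℂ H) (c r e : ℂ) (n k : ℤ) {v : V}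
    (hv : v ∈ weightSpace A Φ H V (mkWeight l c (r + n) e))
    (h : ∀ l', weightSpace A Φ H V (mkWeight l' c (r + (n + k : ℤ)) e) = ⊥) (y : 𝔤) :
    ⁅(LA.tmul (AffVir.x Φ k y) a : LA A Φ), v⁆ = 0 := by
  induction y using root_induction (H := H) with
  | h0 => rw [map_zero, map_zero, LinearMap.zero_apply, zero_lie]
  | hadd y z hy hz => rw [map_add, map_add, LinearMap.add_apply, add_lie, hy, hz, add_zero]
  | hs χ y hy =>
    have := lie_x_mem_weightSpace a l c r e n k hv χ.toLinear y hy
    rwa [h, Submodule.mem_bot] at this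

/-- Among the finitely many weights of the top degree, one with maximal `Re l(h)` is chosen, `h`
being the height element. Positive root vectors would raise this number by the height of the root,
and elements of positive degree land above the top degree. -/
theorem exists_isHighestWeightModule [LieModule.IsIrreducible ℂ (LA A Φ) V]
    (b : (IsKilling.rootSystem H).Base) (hV : IsIntegrable A Φ H V) {c r e : ℂ} {n : ℤ}
    (hne : ∃ l, weightSpace A Φ H V (mkWeight l c (r + n) e) ≠ ⊥)
    (hmax : ∀ l (n' : ℤ), n < n' → weightSpace A Φ H V (mkWeight l c (r + n') e) = ⊥)
    (hfin : {l | weightSpace A Φ H V (mkWeight l c (r + n) e) ≠ ⊥}.Finite) :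
    ∃ μ, IsHighestWeightModule A Φ V b μ ∧ Module.finrank ℂ (weightSpace A Φ H V μ) = 1 := by
  obtain ⟨h, hh⟩ := exists_height_element b
  obtain ⟨l, hl, hlmax⟩ := Set.exists_max_image _ (fun l : Module.Dual ℂ H => (l h).re) hfin hne
  obtain ⟨D, -, hD⟩ := exists_grading_element (Φ := Φ) b
  refine ⟨_, isGeneratedByExtremal_of_lie_eq_zero hV (posPart_sup_negPart b) one_ne_zero D hD _ hl
    fun X hX a v hv => ?_⟩
  induction hX using Submodule.span_induction with
  | mem X hX =>
    obtain (⟨α, hα, y, hy, rfl⟩ | ⟨k, hk, y, rfl⟩) | ⟨k, hk, rfl⟩ := hX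
    · have h1 := lie_x_mem_weightSpace a l c r e n 0 hv α.1.toLinear y hy
      by_contra h0
      have h2 := hlmax (l + α.1.toLinear) (fun hbot => h0 (by
        rwa [add_zero, hbot, Submodule.mem_bot] at h1))
      have h3 : (LieModule.Weight.toLinear ℂ H 𝔤 α.1 h).re = b.height α :=
        (congrArg Complex.re (hh α)).trans (Complex.intCast_re _)
      have h4 : (0 : ℝ) < b.height α := by exact_mod_cast hα
      simp only [LinearMap.add_apply, Complex.add_re, h3] at h2
      linarith
    · exact lie_x_eq_zero_of_forall_eq_bot a l c r e n k hv (fun l' => hmax l' _ (by omega)) y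
    · have h1 := lie_d_mem_weightSpace a l c r e n k hv
      rwa [hmax l _ (by omega), Submodule.mem_bot] at h1
  | zero => rw [map_zero, LinearMap.zero_apply, zero_lie]
  | add y z _ _ hy hz => rw [map_add, LinearMap.add_apply, add_lie, hy, hz, add_zero]
  | smul t z _ hz => rw [map_smul, LinearMap.smul_apply, smul_lie, hz, smul_zero]

theorem exists_isLowestWeightModule [LieModule.IsIrreducible ℂ (LA A Φ) V]
    (b : (IsKilling.rootSystem H).Base) (hV : IsIntegrable A Φ H V) {c r e : ℂ} {n : ℤ}
    (hne : ∃ l, weightSpace A Φ H V (mkWeight l c (r + n) e) ≠ ⊥)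
    (hmin : ∀ l (n' : ℤ), n' < n → weightSpace A Φ H V (mkWeight l c (r + n') e) = ⊥)
    (hfin : {l | weightSpace A Φ H V (mkWeight l c (r + n) e) ≠ ⊥}.Finite) :
    ∃ μ, IsLowestWeightModule A Φ V b μ ∧ Module.finrank ℂ (weightSpace A Φ H V μ) = 1 := by
  obtain ⟨h, hh⟩ := exists_height_element b
  obtain ⟨l, hl, hlmin⟩ := Set.exists_min_image _ (fun l : Module.Dual ℂ H => (l h).re) hfin hne
  obtain ⟨D, hD, -⟩ := exists_grading_element (Φ := Φ) b
  -- The two triangular parts exchange roles, and the sign `s = -1` reverses the grading.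
  refine ⟨_, isGeneratedByExtremal_of_lie_eq_zero hV
    (by rw [sup_comm (negPart Φ b), posPart_sup_negPart b]) (neg_ne_zero.mpr one_ne_zero) D hD _ hl
    fun X hX a v hv => ?_⟩
  induction hX using Submodule.span_induction with
  | mem X hX =>
    obtain (⟨α, hα, y, hy, rfl⟩ | ⟨k, hk, y, rfl⟩) | ⟨k, hk, rfl⟩ := hX
    · have h1 := lie_x_mem_weightSpace a l c r e n 0 hv (-α.1.toLinear) y hy
      by_contra h0
      have h2 := hlmin (l + -α.1.toLinear) (fun hbot => h0 (by
        rwa [add_zero, hbot, Submodule.mem_bot] at h1))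
      have h3 : (LieModule.Weight.toLinear ℂ H 𝔤 α.1 h).re = b.height α :=
        (congrArg Complex.re (hh α)).trans (Complex.intCast_re _)
      have h4 : (0 : ℝ) < b.height α := by exact_mod_cast hα
      simp only [LinearMap.add_apply, LinearMap.neg_apply, Complex.add_re, Complex.neg_re, h3] at h2
      linarith
    · exact lie_x_eq_zero_of_forall_eq_bot a l c r e n k hv (fun l' => hmin l' _ (by omega)) y
    · have h1 := lie_d_mem_weightSpace a l c r e n k hv
      rwa [hmin l _ (by omega), Submodule.mem_bot] at h1
  | zero => rw [map_zero, LinearMap.zero_apply, zero_lie]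
  | add y z _ _ hy hz => rw [map_add, LinearMap.add_apply, add_lie, hy, hz, add_zero]
  | smul t z _ hz => rw [map_smul, LinearMap.smul_apply, smul_lie, hz, smul_zero]

end Integrable

end LoopAffVir

end

/-! ### Assembly: the sign of the level decides between highest and lowest weight. -/

open LoopAffVir
theorem mainTheorem2 {𝔤 : Type*} [LieRing 𝔤] [LieAlgebra ℂ 𝔤] [FiniteDimensional ℂ 𝔤]
    [LieAlgebra.IsSimple ℂ 𝔤] (Φ : InvForm 𝔤)
    (H : LieSubalgebra ℂ 𝔤) [H.IsCartanSubalgebra]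
    (b : (LieAlgebra.IsKilling.rootSystem H).Base)
    (A : Type*) [CommRing A] [Algebra ℂ A] [Algebra.FiniteType ℂ A]
    (V : Type*) [AddCommGroup V] [Module ℂ V] [LieRingModule (LA A Φ) V] [LieModule ℂ (LA A Φ) V]
    [LieModule.IsIrreducible ℂ (LA A Φ) V] (hV : IsIntegrable A Φ H V)
    (hK : ∃ v : V, ⁅(LA.tmul (AffVir.K Φ) 1 : LA A Φ), v⁆ ≠ 0) :
    ((∃ μ, IsHighestWeightModule A Φ V b μ ∧ Module.finrank ℂ (weightSpace A Φ H V μ) = 1) ∨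
      (∃ μ, IsLowestWeightModule A Φ V b μ ∧ Module.finrank ℂ (weightSpace A Φ H V μ) = 1)) ∧
    (IsNormalized Φ b →
      ∃ m : ℤ, m ≠ 0 ∧ (∀ v : V, ⁅(LA.tmul (AffVir.K Φ) 1 : LA A Φ), v⁆ = (m : ℂ) • v) ∧
        (0 < m → ∃ μ, IsHighestWeightModule A Φ V b μ ∧
          Module.finrank ℂ (weightSpace A Φ H V μ) = 1) ∧
        (m < 0 → ∃ μ, IsLowestWeightModule A Φ V b μ ∧
          Module.finrank ℂ (weightSpace A Φ H V μ) = 1)) := by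
  obtain ⟨μ, hμ⟩ : ∃ μ, weightSpace A Φ H V μ ≠ ⊥ := by
    by_contra! hbot
    obtain ⟨v, hv⟩ := hK
    have hv' : v ∈ ⨆ μ, weightSpace A Φ H V μ := by rw [hV.isWeightModule.2]; trivial
    simp only [hbot, iSup_bot, Submodule.mem_bot] at hv'
    exact hv (by rw [hv', lie_zero])
  obtain ⟨l, c, r, e, rfl⟩ := exists_eq_mkWeight μ
  have hc : ∀ v : V, ⁅(LA.tmul (AffVir.K Φ) 1 : LA A Φ), v⁆ = c • v := by
    obtain ⟨v, hv, hv0⟩ := Submodule.exists_mem_ne_zero_of_ne_bot hμ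
    refine lie_K_eq_smul hv0 ?_
    have := hv (0, 1, 0, 0)
    rw [cartanIncl_apply, mkWeight_apply] at this
    simpa using this
  have hc0 : c ≠ 0 := by
    rintro rfl
    obtain ⟨v, hv⟩ := hK
    exact hv (by rw [hc, zero_smul])
  have hroot := nonempty_root H
  let ρ := hV.affRep c r e hc
  have hne : ∃ l n, ρ.W l n ≠ ⊥ := ⟨l, 0, by
    change weightSpace A Φ H V (mkWeight l c (r + (0 : ℤ)) e) ≠ ⊥
    rwa [Int.cast_zero, add_zero]⟩
  obtain ⟨q, hq, hsign⟩ := ρ.exists_level_signs hc0 hne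
  have hpos : (∀ α, 0 < q α) → ∃ μ, IsHighestWeightModule A Φ V b μ ∧
      Module.finrank ℂ (weightSpace A Φ H V μ) = 1 := fun h => by
    obtain ⟨n, h1, h2, h3⟩ := AffRep.IsPositive.exists_greatest (ρ := ρ) (q := q)
      (fun α => ⟨hq α, h α⟩) hne
    exact exists_isHighestWeightModule b hV h1 h2 h3
  have hneg : (∀ α, q α < 0) → ∃ μ, IsLowestWeightModule A Φ V b μ ∧
      Module.finrank ℂ (weightSpace A Φ H V μ) = 1 := fun h => by
    -- Under `t ↦ t⁻¹` the level changes sign and degrees are negated, so the greatest degree of the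
    -- flip is the least degree of `ρ` up to sign.
    obtain ⟨n, h1, h2, h3⟩ := AffRep.IsPositive.exists_greatest (ρ := ρ.flip) (q := fun α => -q α)
      (fun α => ⟨by
        change -ρ.level * _ = _
        rw [neg_mul, hq, Int.cast_neg], neg_pos.mpr (h α)⟩)
      (by obtain ⟨l, n, hln⟩ := hne; exact ⟨l, -n, by change ρ.W l (- -n) ≠ ⊥; rwa [neg_neg]⟩)
    refine exists_isLowestWeightModule b hV h1 (fun l n' hn => ?_) h3
    have := h2 l (-n') (by omega)
    change ρ.W l (- -n') = ⊥ at this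
    rwa [neg_neg] at this
  refine ⟨hsign.imp hpos hneg, ?_⟩
  rintro ⟨θ, -, hθ⟩
  -- The normalization `⟨θ^∨, θ^∨⟩ = 2` makes `q θ` equal to the level itself, so the integer is `m
  -- = q θ`.
  have hcq : c = q θ := by
    rw [← hq θ, hθ]
    change c = c * (2 / 2)
    norm_num
  refine ⟨q θ, fun h => hc0 (by rw [hcq, h, Int.cast_zero]), fun v => by rw [hc, hcq],
    fun h => hpos ?_, fun h => hneg ?_⟩
  · exact hsign.resolve_right fun h' => (h.trans (h' θ)).false
  · exact hsign.resolve_left fun h' => (h.trans (h' θ)).false
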